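/- **Setting.** Let $H^2(\mathbb D)$, $H^2(\mathbb D^2)$ and, for a complex Hilbert space $E$, $H^2(\mathbb D;E)$ be the Hardy spaces of functions with square-summable Taylor coefficients, normed by the $\ell^2$ norm of the coefficients. An *inner function* $\Phi\in H^\infty(\mathbb D;\mathcal B(E,F))$ is a bounded analytic $\mathcal B(E,F)$-valued function on $\mathbb D$ such that $f\mapsto \Phi f$ is an isometry $H^2(\mathbb D;E)\to H^2(\mathbb D;F)$; scalar inner functions are the case $E=F=\mathbb C$. For a scalar inner function $\varphi$ put $K_\varphi=H^2(\mathbb D)\ominus\varphi H^2(\mathbb D)$. For a function $h$ of one variable write $h_{z_2}(z_1,z_2)=h(z_2)$, and let $h_{z_2}H^2_{z_1}(\mathbb D)$ be the space of functions $h(z_2)f(z_1)$ with $f\in H^2(\mathbb D)$. Identify $H^2(\mathbb D^2)$ with $H^2(\mathbb D;H^2(\mathbb D))$ through the variable $z_1$; so for $\Psi\in H^\infty(\mathbb D;\mathcal B(E,K_\varphi))$ and $f\in H^2(\mathbb D;E)$, $\Psi f$ is the function $(z_1,z_2)\mapsto(\Psi(z_1)f(z_1))(z_2)$. For $\sigma>0$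 and $\theta\in[0,2\pi)$ the *3-Brownian shift* $T_{\sigma,\theta}$ on $H^2(\mathbb D^2)\oplus H^2(\mathbb D)\oplus\mathbb C$ is $$T_{\sigma,\theta}(F,f,\alpha)=\bigl(z_1F+\sigma f_{z_2},\ zf+\sigma\alpha,\ e^{i\theta}\alpha\bigr).$$ Let $\mathcal M=\mathcal M_0\oplus\mathcal M_1$ with $\mathcal M_0\subseteq H^2(\mathbb D^2)$ and $\mathcal M_1\subseteq H^2(\mathbb D)\oplus\mathbb C$, and let $\mathcal E_{\mathcal M}$ be a Hilbert space. In the following, all sums $\oplus$ are orthogonal. * $\mathcal M$ is of *lifted Type I* (with multiplicity space $\mathcal E_{\mathcal M}$) if there are a scalar inner function $\varphi$ and an inner function $\Psi\in H^\infty(\mathbb D;\mathcal B(\mathcal E_{\mathcal M},K_\varphi))$ with $$\mathcal M_1=\varphi H^2(\mathbb D)\oplus\{0\},\qquad \mathcal M_0=\varphi_{z_2}H^2(\mathbb D^2)\oplus\Psi H^2(\mathbb D;\mathcal E_{\mathcal M}).$$ * $\mathcal M$ is of *lifted Type II* for $T_{\sigma,\theta}$ (with multiplicity space $\mathcal E_{\mathcal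 M}$ and function $g$) if there are a scalar inner function $\varphi$ whose radial limit $\varphi(e^{i\theta})$ exists and for which $$g(z)=\sigma\,\frac{\overline{\varphi(e^{i\theta})}\,\varphi(z)-1}{z-e^{i\theta}}$$ belongs to $H^2(\mathbb D)$, and an inner function $\Psi\in H^\infty(\mathbb D;\mathcal B(\mathcal E_{\mathcal M},K_\varphi))$ with $\Psi(0)\mathcal E_{\mathcal M}\perp g$, such that $$\mathcal M_1=\mathbb C\begin{bmatrix}g\\1\end{bmatrix}\oplus\bigl(\varphi H^2(\mathbb D)\oplus\{0\}\bigr),\qquad \mathcal M_0=\varphi_{z_2}H^2(\mathbb D^2)\oplus g_{z_2}H^2_{z_1}(\mathbb D)\oplus\Psi H^2(\mathbb D;\mathcal E_{\mathcal M}).$$ **Theorem.** Let $\theta_1,\theta_2\in[0,2\pi)$ and $\sigma_1,\sigma_2>0$. Let $\mathcal M$ and $\mathcal N$ be nonzero closed invariant subspaces of $T_{\sigma_1,\theta_1}$ and $T_{\sigma_2,\theta_2}$, respectively, each of lifted Type I or lifted Type II, with multiplicity spaces $\mathcal E_{\mathcal M}$ and $\mathcal E_{\mathcal N}$. Then there is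 a unitary $U:\mathcal M\to\mathcal N$ with $U\,T_{\sigma_1,\theta_1}|_{\mathcal M}=T_{\sigma_2,\theta_2}|_{\mathcal N}\,U$ if and only if $\sigma_1=\sigma_2$, $\dim\mathcal E_{\mathcal M}=\dim\mathcal E_{\mathcal N}$ (Hilbert space dimension), and one of the following holds: 1. both $\mathcal M$ and $\mathcal N$ are of lifted Type I; 2. both $\mathcal M$ and $\mathcal N$ are of lifted Type II, with functions $g^{(1)}$ and $g^{(2)}$ respectively, and $\theta_1=\theta_2$ and $\|g^{(1)}\|=\|g^{(2)}\|$. -/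

import Mathlib

open scoped ComplexConjugate Topology InnerProductSpace Complex.UnitDisc

universe u v

noncomputable section

/-! ### Square-summable families: helper facts -/

theorem lpTwo_summable_sq {ι : Type*} {E : Type*} [NormedAddCommGroup E]
    (a : lp (fun _ : ι => E) 2) : Summable fun i => ‖a i‖ ^ 2 := by
  simpa using (lp.memℓp a).summable (by simp)

theorem lpTwo_summable_smul {ι : Type*} {E : Type*} [NormedAddCommGroup E] [NormedSpace ℂ E]
    [CompleteSpace E] {c : ι → ℂ} (hc : Summable fun i => ‖c i‖ ^ 2)
    (a : lp (fun _ : ι => E) 2) : Summable fun i => c i • a i := by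
  refine Summable.of_norm_bounded (hc.add (lpTwo_summable_sq a)) fun i => ?_
  rw [norm_smul]
  nlinarith [sq_nonneg (‖c i‖ - ‖a i‖), sq_nonneg (‖c i‖), sq_nonneg (‖a i‖)]

theorem unitDisc_summable_sq (z : 𝔻) : Summable fun n : ℕ => ‖(z : ℂ) ^ n‖ ^ 2 := by
  have h : (fun n : ℕ => ‖(z : ℂ) ^ n‖ ^ 2) = fun n : ℕ => (‖(z : ℂ)‖ ^ 2) ^ n := by
    funext n
    rw [norm_pow, ← pow_mul, ← pow_mul, mul_comm]
  rw [h]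
  exact summable_geometric_of_lt_one (by positivity) z.sq_norm_lt_one

theorem unitBidisc_summable_sq (p : 𝔻 × 𝔻) :
    Summable fun k : ℕ × ℕ => ‖(p.1 : ℂ) ^ k.1 * (p.2 : ℂ) ^ k.2‖ ^ 2 := by
  have h := (unitDisc_summable_sq p.1).mul_of_nonneg (unitDisc_summable_sq p.2)
    (fun _ => by positivity) (fun _ => by positivity)
  refine h.congr fun k => ?_
  rw [norm_mul, mul_pow]

theorem unitDisc_coeff_eq_zero {E : Type*} [NormedAddCommGroup E] [NormedSpace ℂ E]
    {a : ℕ → E} (h : ∀ z : 𝔻, HasSum (fun n => (z : ℂ) ^ n • a n) 0) (n : ℕ) : a n = 0 := by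
  let p : FormalMultilinearSeries ℂ ℂ E := fun n => ContinuousMultilinearMap.mkPiRing ℂ (Fin n) (a n)
  have hcoeff : ∀ n, p.coeff n = a n := by
    intro n
    simp [p, FormalMultilinearSeries.coeff]
  have hp : HasFPowerSeriesAt (fun _ : ℂ => (0 : E)) p 0 := by
    rw [hasFPowerSeriesAt_iff]
    filter_upwards [Metric.ball_mem_nhds (0 : ℂ) one_pos] with z hz
    have hz' := h (Complex.UnitDisc.mk z (by simpa using hz))
    rw [Complex.UnitDisc.coe_mk] at hz'
    simpa only [hcoeff] using hz'
  rw [← hcoeff, hp.eq_zero]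
  simp [FormalMultilinearSeries.coeff]

/-- A square-summable family can be pushed forward along an injection without changing its norm. -/
theorem lpTwo_exists_extend {ι κ : Type*} {E : Type*} [NormedAddCommGroup E] {e : ι → κ}
    (he : Function.Injective e) (a : lp (fun _ : ι => E) 2) :
    ∃ b : lp (fun _ : κ => E) 2,
      (∀ i, b (e i) = a i) ∧ (∀ k, k ∉ Set.range e → b k = 0) ∧ ‖b‖ = ‖a‖ := by
  have h0 : ∀ k, k ∉ Set.range e → Function.extend e (a : ι → E) 0 k = 0 := fun k hk => by
    rw [Function.extend_apply' _ _ _ (by simpa using hk)]; rfl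
  have hs : ∀ k, k ∉ Set.range e → ‖Function.extend e (a : ι → E) 0 k‖ ^ (2 : ENNReal).toReal = 0 :=
    fun k hk => by rw [h0 k hk]; simp
  have hc : (fun k => ‖Function.extend e (a : ι → E) 0 k‖ ^ (2 : ENNReal).toReal) ∘ e =
      fun i => ‖a i‖ ^ (2 : ENNReal).toReal := by
    funext i; simp [he.extend_apply]
  have hmem : Memℓp (Function.extend e (a : ι → E) 0) 2 := by
    rw [memℓp_gen_iff (by simp), ← he.summable_iff hs, hc]
    exact (lp.memℓp a).summable (by simp)
  refine ⟨⟨_, hmem⟩, fun i => he.extend_apply _ _ _, h0, ?_⟩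
  rw [lp.norm_eq_tsum_rpow (by simp), lp.norm_eq_tsum_rpow (by simp)]
  congr 1
  rw [← he.tsum_eq (f := fun k => ‖Function.extend e (a : ι → E) 0 k‖ ^ (2 : ENNReal).toReal)
    (Function.support_subset_iff'.2 hs)]
  exact congrArg tsum hc

/-! ### The Hardy space `H²(𝔻; E)` -/

section HardyDisc

variable (E : Type u) [NormedAddCommGroup E] [InnerProductSpace ℂ E] [CompleteSpace E]

/-- The function `z ↦ ∑ aₙ zⁿ` on the disc with a given square-summable coefficient sequence. -/
def hardyDiscSeries : lp (fun _ : ℕ => E) 2 →ₗ[ℂ] (𝔻 → E) where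
  toFun a z := ∑' n : ℕ, (z : ℂ) ^ n • a n
  map_add' a b := by
    funext z
    simp only [lp.coeFn_add, Pi.add_apply, smul_add]
    exact (lpTwo_summable_smul (unitDisc_summable_sq z) a).tsum_add
      (lpTwo_summable_smul (unitDisc_summable_sq z) b)
  map_smul' c a := by
    funext z
    simp only [lp.coeFn_smul, Pi.smul_apply, RingHom.id_apply, smul_comm _ c]
    exact (lpTwo_summable_smul (unitDisc_summable_sq z) a).tsum_const_smul c

theorem hardyDiscSeries_injective : Function.Injective (hardyDiscSeries E) := by
  rw [injective_iff_map_eq_zero]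
  intro a ha
  ext n
  refine unitDisc_coeff_eq_zero (fun z => ?_) n
  have h := (lpTwo_summable_smul (unitDisc_summable_sq z) a).hasSum
  have h2 : ∑' n : ℕ, (z : ℂ) ^ n • a n = 0 := congrFun ha z
  rwa [h2] at h

/-- `H²(𝔻; E)`: the functions `f(z) = ∑ aₙ zⁿ` on the disc with `∑ ‖aₙ‖² < ∞`. -/
def HardyDisc : Type u := LinearMap.range (hardyDiscSeries E)

namespace HardyDisc

instance : AddCommGroup (HardyDisc E) :=
  inferInstanceAs (AddCommGroup (LinearMap.range (hardyDiscSeries E)))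

instance : Module ℂ (HardyDisc E) :=
  inferInstanceAs (Module ℂ (LinearMap.range (hardyDiscSeries E)))

instance : CoeFun (HardyDisc E) (fun _ => 𝔻 → E) := ⟨fun f => f.1⟩

/-- The linear bijection that sends a function to its sequence of Taylor coefficients. -/
def coeffEquiv : HardyDisc E ≃ₗ[ℂ] lp (fun _ : ℕ => E) 2 :=
  (LinearEquiv.ofInjective (hardyDiscSeries E) (hardyDiscSeries_injective E)).symm

/-- The norm is the `ℓ²` norm of the Taylor coefficients. -/
instance : NormedAddCommGroup (HardyDisc E) :=
  NormedAddCommGroup.induced _ _ (coeffEquiv E) (coeffEquiv E).injective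

instance : InnerProductSpace ℂ (HardyDisc E) := InnerProductSpace.induced (coeffEquiv E)

/-- Taylor coefficients as a unitary map. -/
def coeff : HardyDisc E ≃ₗᵢ[ℂ] lp (fun _ : ℕ => E) 2 where
  toLinearEquiv := coeffEquiv E
  norm_map' _ := rfl

instance : CompleteSpace (HardyDisc E) :=
  (completeSpace_congr (e := (coeff E).toEquiv) (coeff E).isometry.isUniformEmbedding).2 inferInstance

end HardyDisc

end HardyDisc

namespace HardyDisc

variable {E : Type u} [NormedAddCommGroup E] [InnerProductSpace ℂ E] [CompleteSpace E]

@[ext] theorem ext {f g : HardyDisc E} (h : ∀ z, f z = g z) : f = g := Subtype.ext (funext h)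

@[simp] theorem add_apply (f g : HardyDisc E) (z : 𝔻) : (f + g) z = f z + g z := rfl

@[simp] theorem smul_apply (c : ℂ) (f : HardyDisc E) (z : 𝔻) : (c • f) z = c • f z := rfl

@[simp] theorem zero_apply (z : 𝔻) : (0 : HardyDisc E) z = 0 := rfl

theorem hasSum_coeff (f : HardyDisc E) (z : 𝔻) :
    HasSum (fun n : ℕ => (z : ℂ) ^ n • coeff E f n) (f z) := by
  have h := (lpTwo_summable_smul (unitDisc_summable_sq z) (coeff E f)).hasSum
  have h2 : hardyDiscSeries E (coeff E f) = f.1 :=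
    congrArg Subtype.val ((LinearEquiv.ofInjective (hardyDiscSeries E)
      (hardyDiscSeries_injective E)).apply_symm_apply f)
  have h3 : ∑' n : ℕ, (z : ℂ) ^ n • coeff E f n = f z := congrFun h2 z
  rwa [h3] at h

/-- A function which is the sum of a power series with square-summable coefficients, as an element
of the Hardy space, together with its norm. -/
theorem exists_of_hasSum {F : 𝔻 → E} (a : lp (fun _ : ℕ => E) 2)
    (h : ∀ z : 𝔻, HasSum (fun n : ℕ => (z : ℂ) ^ n • a n) (F z)) :
    ∃ f : HardyDisc E, f.1 = F ∧ ‖f‖ = ‖a‖ :=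
  ⟨(coeff E).symm a, funext fun z => (h z).tsum_eq, (coeff E).symm.norm_map a⟩

end HardyDisc

/-! ### The Hardy space `H²(𝔻²)` -/

/-- The function `(z₁, z₂) ↦ ∑ aₘₙ z₁ᵐ z₂ⁿ` on the bidisc with a given square-summable family of
coefficients. -/
def hardyBidiscSeries : lp (fun _ : ℕ × ℕ => ℂ) 2 →ₗ[ℂ] (𝔻 × 𝔻 → ℂ) where
  toFun a p := ∑' k : ℕ × ℕ, ((p.1 : ℂ) ^ k.1 * (p.2 : ℂ) ^ k.2) • a k
  map_add' a b := by
    funext p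
    simp only [lp.coeFn_add, Pi.add_apply, smul_add]
    exact (lpTwo_summable_smul (unitBidisc_summable_sq p) a).tsum_add
      (lpTwo_summable_smul (unitBidisc_summable_sq p) b)
  map_smul' c a := by
    funext p
    simp only [lp.coeFn_smul, Pi.smul_apply, RingHom.id_apply, smul_comm _ c]
    exact (lpTwo_summable_smul (unitBidisc_summable_sq p) a).tsum_const_smul c

theorem hardyBidiscSeries_injective : Function.Injective hardyBidiscSeries := by
  rw [injective_iff_map_eq_zero]
  intro a ha
  have hs : ∀ z w : 𝔻, HasSum (fun k : ℕ × ℕ => ((z : ℂ) ^ k.1 * (w : ℂ) ^ k.2) • a k) 0 := by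
    intro z w
    have h := (lpTwo_summable_smul (unitBidisc_summable_sq (z, w)) a).hasSum
    have h2 : ∑' k : ℕ × ℕ, ((z : ℂ) ^ k.1 * (w : ℂ) ^ k.2) • a k = 0 := congrFun ha (z, w)
    rwa [h2] at h
  have hrow : ∀ (w : 𝔻) (m : ℕ), Summable fun n : ℕ => (w : ℂ) ^ n • a (m, n) := by
    intro w m
    refine Summable.of_norm_bounded ((unitDisc_summable_sq w).add
      ((lpTwo_summable_sq a).comp_injective (i := fun n : ℕ => (m, n))
        fun _ _ h => (Prod.ext_iff.1 h).2)) fun n => ?_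
    rw [norm_smul, Function.comp_apply]
    nlinarith [sq_nonneg (‖(w : ℂ) ^ n‖ - ‖a (m, n)‖), sq_nonneg (‖(w : ℂ) ^ n‖),
      sq_nonneg (‖a (m, n)‖)]
  have h1 : ∀ (w : 𝔻) (m : ℕ), ∑' n : ℕ, (w : ℂ) ^ n • a (m, n) = 0 := by
    intro w
    refine unitDisc_coeff_eq_zero fun z => ?_
    refine (hs z w).prod_fiberwise fun m => ?_
    have := (hrow w m).hasSum.const_smul ((z : ℂ) ^ m)
    simpa only [smul_smul] using this
  ext ⟨m, n⟩
  refine unitDisc_coeff_eq_zero (a := fun n => a (m, n)) (fun w => ?_) n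
  have h := (hrow w m).hasSum
  rwa [h1] at h

/-- `H²(𝔻²)`: the functions `F(z₁, z₂) = ∑ aₘₙ z₁ᵐ z₂ⁿ` on the bidisc with `∑ |aₘₙ|² < ∞`. -/
def HardyBidisc : Type := LinearMap.range hardyBidiscSeries

namespace HardyBidisc

instance : AddCommGroup HardyBidisc :=
  inferInstanceAs (AddCommGroup (LinearMap.range hardyBidiscSeries))

instance : Module ℂ HardyBidisc :=
  inferInstanceAs (Module ℂ (LinearMap.range hardyBidiscSeries))

instance : CoeFun HardyBidisc (fun _ => 𝔻 × 𝔻 → ℂ) := ⟨fun f => f.1⟩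

/-- The linear bijection that sends a function to its family of Taylor coefficients. -/
def coeffEquiv : HardyBidisc ≃ₗ[ℂ] lp (fun _ : ℕ × ℕ => ℂ) 2 :=
  (LinearEquiv.ofInjective hardyBidiscSeries hardyBidiscSeries_injective).symm

/-- The norm is the `ℓ²` norm of the Taylor coefficients. -/
instance : NormedAddCommGroup HardyBidisc :=
  NormedAddCommGroup.induced _ _ coeffEquiv coeffEquiv.injective

instance : InnerProductSpace ℂ HardyBidisc := InnerProductSpace.induced coeffEquiv

/-- Taylor coefficients as a unitary map. -/
def coeff : HardyBidisc ≃ₗᵢ[ℂ] lp (fun _ : ℕ × ℕ => ℂ) 2 where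
  toLinearEquiv := coeffEquiv
  norm_map' _ := rfl

instance : CompleteSpace HardyBidisc :=
  (completeSpace_congr (e := coeff.toEquiv) coeff.isometry.isUniformEmbedding).2 inferInstance

@[ext] theorem ext {f g : HardyBidisc} (h : ∀ p, f p = g p) : f = g := Subtype.ext (funext h)

@[simp] theorem add_apply (f g : HardyBidisc) (p : 𝔻 × 𝔻) : (f + g) p = f p + g p := rfl

@[simp] theorem smul_apply (c : ℂ) (f : HardyBidisc) (p : 𝔻 × 𝔻) : (c • f) p = c • f p := rfl

@[simp] theorem zero_apply (p : 𝔻 × 𝔻) : (0 : HardyBidisc) p = 0 := rfl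

theorem hasSum_coeff (f : HardyBidisc) (p : 𝔻 × 𝔻) :
    HasSum (fun k : ℕ × ℕ => ((p.1 : ℂ) ^ k.1 * (p.2 : ℂ) ^ k.2) • coeff f k) (f p) := by
  have h := (lpTwo_summable_smul (unitBidisc_summable_sq p) (coeff f)).hasSum
  have h2 : hardyBidiscSeries (coeff f) = f.1 :=
    congrArg Subtype.val ((LinearEquiv.ofInjective hardyBidiscSeries
      hardyBidiscSeries_injective).apply_symm_apply f)
  have h3 : ∑' k : ℕ × ℕ, ((p.1 : ℂ) ^ k.1 * (p.2 : ℂ) ^ k.2) • coeff f k = f p := congrFun h2 p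
  rwa [h3] at h

theorem exists_of_hasSum {F : 𝔻 × 𝔻 → ℂ} (a : lp (fun _ : ℕ × ℕ => ℂ) 2)
    (h : ∀ p : 𝔻 × 𝔻, HasSum (fun k : ℕ × ℕ => ((p.1 : ℂ) ^ k.1 * (p.2 : ℂ) ^ k.2) • a k) (F p)) :
    ∃ f : HardyBidisc, f.1 = F ∧ ‖f‖ = ‖a‖ :=
  ⟨coeff.symm a, funext fun p => (h p).tsum_eq, coeff.symm.norm_map a⟩

end HardyBidisc

/-! ### The 3-Brownian shift -/

theorem exists_hardyShift (f : HardyDisc ℂ) :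
    ∃ h : HardyDisc ℂ, h.1 = (fun z : 𝔻 => (z : ℂ) * f z) ∧ ‖h‖ = ‖f‖ := by
  obtain ⟨b, hb, hb0, hn⟩ := lpTwo_exists_extend Nat.succ_injective (HardyDisc.coeff ℂ f)
  obtain ⟨h, hh, hhn⟩ := HardyDisc.exists_of_hasSum (F := fun z : 𝔻 => (z : ℂ) * f z) b fun z => by
    rw [← Function.Injective.hasSum_iff Nat.succ_injective fun k hk => by rw [hb0 k hk, smul_zero]]
    refine ((f.hasSum_coeff z).mul_left (z : ℂ)).congr_fun ?_
    intro n
    simp only [Function.comp_apply, hb, smul_eq_mul, Nat.succ_eq_add_one]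
    ring
  exact ⟨h, hh, by rw [hhn, hn, LinearIsometryEquiv.norm_map]⟩

/-- The unilateral shift `S` on `H²(𝔻)`: `(S f)(z) = z f(z)`. -/
def hardyShift : HardyDisc ℂ →ₗᵢ[ℂ] HardyDisc ℂ where
  toFun f := ⟨fun z => (z : ℂ) * f z, by
    obtain ⟨h, hh, -⟩ := exists_hardyShift f
    exact hh ▸ h.2⟩
  map_add' f g := HardyDisc.ext fun z => mul_add (z : ℂ) (f z) (g z)
  map_smul' c f := HardyDisc.ext fun z => mul_left_comm (z : ℂ) c (f z)
  norm_map' f := by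
    obtain ⟨h, hh, hn⟩ := exists_hardyShift f
    rw [← hn]
    exact congrArg norm (Subtype.ext hh.symm)

theorem exists_hardyConst (c : ℂ) :
    ∃ h : HardyDisc ℂ, h.1 = (fun _ : 𝔻 => c) ∧ ‖h‖ = ‖c‖ := by
  obtain ⟨h, hh, hhn⟩ := HardyDisc.exists_of_hasSum (F := fun _ : 𝔻 => c)
    (lp.single 2 (0 : ℕ) c) fun z => by
      have h := hasSum_single (f := fun n : ℕ => (z : ℂ) ^ n •
        (lp.single 2 (0 : ℕ) c : lp (fun _ : ℕ => ℂ) 2) n) 0 fun n hn => by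
          rw [lp.single_apply_ne _ _ _ hn, smul_zero]
      rwa [pow_zero, one_smul, lp.single_apply_self] at h
  exact ⟨h, hh, by rw [hhn, lp.norm_single (by simp)]⟩

/-- The operator `1 ⊗ 1 : ℂ → H²(𝔻)` that sends a scalar to the constant function. -/
def hardyConst : ℂ →ₗᵢ[ℂ] HardyDisc ℂ where
  toFun c := ⟨fun _ => c, by
    obtain ⟨h, hh, -⟩ := exists_hardyConst c
    exact hh ▸ h.2⟩
  map_add' _ _ := rfl
  map_smul' _ _ := rfl
  norm_map' c := by
    obtain ⟨h, hh, hn⟩ := exists_hardyConst c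
    rw [← hn]
    exact congrArg norm (Subtype.ext hh.symm)

theorem exists_bidiscShift (F : HardyBidisc) :
    ∃ h : HardyBidisc, h.1 = (fun p : 𝔻 × 𝔻 => (p.1 : ℂ) * F p) ∧ ‖h‖ = ‖F‖ := by
  have he : Function.Injective fun k : ℕ × ℕ => (k.1 + 1, k.2) := by
    rintro ⟨a, b⟩ ⟨c, d⟩ h
    simpa using h
  obtain ⟨b, hb, hb0, hn⟩ := lpTwo_exists_extend he (HardyBidisc.coeff F)
  obtain ⟨h, hh, hhn⟩ := HardyBidisc.exists_of_hasSum
    (F := fun p : 𝔻 × 𝔻 => (p.1 : ℂ) * F p) b fun p => by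
    rw [← Function.Injective.hasSum_iff he fun k hk => by rw [hb0 k hk, smul_zero]]
    refine ((F.hasSum_coeff p).mul_left (p.1 : ℂ)).congr_fun ?_
    intro k
    simp only [Function.comp_apply, hb, smul_eq_mul]
    ring
  exact ⟨h, hh, by rw [hhn, hn, LinearIsometryEquiv.norm_map]⟩

/-- The operator `M_{z₁}` on `H²(𝔻²)`: `(M_{z₁} F)(z₁, z₂) = z₁ F(z₁, z₂)`. -/
def bidiscShift : HardyBidisc →ₗᵢ[ℂ] HardyBidisc where
  toFun F := ⟨fun p => (p.1 : ℂ) * F p, by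
    obtain ⟨h, hh, -⟩ := exists_bidiscShift F
    exact hh ▸ h.2⟩
  map_add' f g := HardyBidisc.ext fun p => mul_add (p.1 : ℂ) (f p) (g p)
  map_smul' c f := HardyBidisc.ext fun p => mul_left_comm (p.1 : ℂ) c (f p)
  norm_map' f := by
    obtain ⟨h, hh, hn⟩ := exists_bidiscShift f
    rw [← hn]
    exact congrArg norm (Subtype.ext hh.symm)

theorem exists_bidiscEmbed (f : HardyDisc ℂ) :
    ∃ h : HardyBidisc, h.1 = (fun p : 𝔻 × 𝔻 => f p.2) ∧ ‖h‖ = ‖f‖ := by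
  have he : Function.Injective fun n : ℕ => ((0 : ℕ), n) := fun a b h => by simpa using h
  obtain ⟨b, hb, hb0, hn⟩ := lpTwo_exists_extend he (HardyDisc.coeff ℂ f)
  obtain ⟨h, hh, hhn⟩ := HardyBidisc.exists_of_hasSum (F := fun p : 𝔻 × 𝔻 => f p.2) b fun p => by
    rw [← Function.Injective.hasSum_iff he fun k hk => by rw [hb0 k hk, smul_zero]]
    refine (f.hasSum_coeff p.2).congr_fun ?_
    intro n
    simp only [Function.comp_apply, hb, smul_eq_mul, pow_zero, one_mul]
  exact ⟨h, hh, by rw [hhn, hn, LinearIsometryEquiv.norm_map]⟩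

/-- The isometric embedding `J : H²(𝔻) → H²(𝔻²)`: `(J f)(z₁, z₂) = f(z₂)`. -/
def bidiscEmbed : HardyDisc ℂ →ₗᵢ[ℂ] HardyBidisc where
  toFun f := ⟨fun p => f p.2, by
    obtain ⟨h, hh, -⟩ := exists_bidiscEmbed f
    exact hh ▸ h.2⟩
  map_add' _ _ := rfl
  map_smul' _ _ := rfl
  norm_map' f := by
    obtain ⟨h, hh, hn⟩ := exists_bidiscEmbed f
    rw [← hn]
    exact congrArg norm (Subtype.ext hh.symm)

/-- The Hilbert space `H²(𝔻) ⊕ ℂ`. -/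
abbrev LowerSpace : Type := WithLp 2 (HardyDisc ℂ × ℂ)

/-- The Hilbert space `H²(𝔻²) ⊕ (H²(𝔻) ⊕ ℂ)`. -/
abbrev BrownianSpace : Type := WithLp 2 (HardyBidisc × LowerSpace)

/-- The Brownian shift `(f, α) ↦ (S f + σ α, e^{iθ} α)` on `H²(𝔻) ⊕ ℂ`. -/
def brownianShift (σ θ : ℝ) : LowerSpace →L[ℂ] LowerSpace :=
  let π₁ := WithLp.fstL 2 ℂ (HardyDisc ℂ) ℂ
  let π₂ := WithLp.sndL 2 ℂ (HardyDisc ℂ) ℂ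
  (WithLp.prodContinuousLinearEquiv 2 ℂ (HardyDisc ℂ) ℂ).symm.toContinuousLinearMap ∘L
    ((hardyShift.toContinuousLinearMap ∘L π₁ +
        (σ : ℂ) • (hardyConst.toContinuousLinearMap ∘L π₂)).prod
      (Complex.exp (Complex.I * θ) • π₂))

/-- The 3-Brownian shift `(F, f, α) ↦ (M_{z₁} F + σ J f, S f + σ α, e^{iθ} α)`. -/
def threeBrownianShift (σ θ : ℝ) : BrownianSpace →L[ℂ] BrownianSpace :=
  let π₀ := WithLp.fstL 2 ℂ HardyBidisc LowerSpace
  let π₁₂ := WithLp.sndL 2 ℂ HardyBidisc LowerSpace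
  let π₁ := WithLp.fstL 2 ℂ (HardyDisc ℂ) ℂ
  (WithLp.prodContinuousLinearEquiv 2 ℂ HardyBidisc LowerSpace).symm.toContinuousLinearMap ∘L
    ((bidiscShift.toContinuousLinearMap ∘L π₀ +
        (σ : ℂ) • (bidiscEmbed.toContinuousLinearMap ∘L π₁ ∘L π₁₂)).prod
      (brownianShift σ θ ∘L π₁₂))

theorem threeBrownianShift_apply (σ θ : ℝ) (F : HardyBidisc) (f : HardyDisc ℂ) (α : ℂ) :
    threeBrownianShift σ θ (WithLp.toLp 2 (F, WithLp.toLp 2 (f, α))) =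
      WithLp.toLp 2 (bidiscShift F + (σ : ℂ) • bidiscEmbed f,
        WithLp.toLp 2 (hardyShift f + (σ : ℂ) • hardyConst α,
          Complex.exp (Complex.I * θ) * α)) := rfl

/-! ### Inner functions and model spaces -/

section Inner

variable {E : Type u} [NormedAddCommGroup E] [InnerProductSpace ℂ E] [CompleteSpace E]
variable {F : Type v} [NormedAddCommGroup F] [InnerProductSpace ℂ F] [CompleteSpace F]

/-- `Φ ∈ H^∞(𝔻; 𝓑(E, F))`: bounded and analytic on the open unit disc (the values of `Φ` outside
the disc are irrelevant). -/
def IsHInfty (Φ : ℂ → E →L[ℂ] F) : Prop :=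
  DifferentiableOn ℂ Φ (Metric.ball 0 1) ∧ ∃ C : ℝ, ∀ z : 𝔻, ‖Φ z‖ ≤ C

/-- `Φ` is an inner function: `Φ ∈ H^∞(𝔻; 𝓑(E, F))` and the multiplication operator
`M_Φ : H²(𝔻; E) → H²(𝔻; F)`, `(M_Φ f)(z) = Φ(z) f(z)`, is an isometry. -/
def IsInner (Φ : ℂ → E →L[ℂ] F) : Prop :=
  IsHInfty Φ ∧
    ∀ f : HardyDisc E, ∃ h : HardyDisc F, (∀ z : 𝔻, h z = Φ z (f z)) ∧ ‖h‖ = ‖f‖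

end Inner

/-- Scalar inner functions: `φ` acts on `ℂ` by multiplication. -/
def IsScalarInner (φ : ℂ → ℂ) : Prop :=
  IsInner fun z => φ z • ContinuousLinearMap.id ℂ ℂ

/-- The subspace `φ H²(𝔻)` of `H²(𝔻)`. -/
def innerRange (φ : ℂ → ℂ) : Submodule ℂ (HardyDisc ℂ) where
  carrier := {h | ∃ f : HardyDisc ℂ, ∀ z : 𝔻, h z = φ z * f z}
  zero_mem' := ⟨0, fun z => by simp⟩
  add_mem' := by
    rintro a b ⟨f, hf⟩ ⟨g, hg⟩
    exact ⟨f + g, fun z => by simp [hf, hg, mul_add]⟩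
  smul_mem' := by
    rintro c a ⟨f, hf⟩
    exact ⟨c • f, fun z => by simp [hf, mul_left_comm]⟩

/-- The model space `K_φ = H²(𝔻) ⊖ φ H²(𝔻)`. -/
abbrev ModelSpace (φ : ℂ → ℂ) : Submodule ℂ (HardyDisc ℂ) := (innerRange φ)ᗮ

/-- The subspace `φ_{z₂} H²(𝔻²)` of `H²(𝔻²)`, where `φ_{z₂}(z₁, z₂) = φ(z₂)`. -/
def bidiscInnerRange (φ : ℂ → ℂ) : Submodule ℂ HardyBidisc where
  carrier := {H | ∃ G : HardyBidisc, ∀ z w : 𝔻, H (z, w) = φ w * G (z, w)}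
  zero_mem' := ⟨0, fun z w => by simp⟩
  add_mem' := by
    rintro a b ⟨f, hf⟩ ⟨g, hg⟩
    exact ⟨f + g, fun z w => by simp [hf, hg, mul_add]⟩
  smul_mem' := by
    rintro c a ⟨f, hf⟩
    exact ⟨c • f, fun z w => by simp [hf, mul_left_comm]⟩

/-- The subspace `g_{z₂} H²_{z₁}(𝔻)` of `H²(𝔻²)`: the functions `(z₁, z₂) ↦ g(z₂) f(z₁)` with
`f ∈ H²(𝔻)`. -/
def bidiscTensorRange (g : HardyDisc ℂ) : Submodule ℂ HardyBidisc where
  carrier := {H | ∃ f : HardyDisc ℂ, ∀ z w : 𝔻, H (z, w) = g w * f z}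
  zero_mem' := ⟨0, fun z w => by simp⟩
  add_mem' := by
    rintro a b ⟨f, hf⟩ ⟨k, hk⟩
    exact ⟨f + k, fun z w => by simp [hf, hk, mul_add]⟩
  smul_mem' := by
    rintro c a ⟨f, hf⟩
    exact ⟨c • f, fun z w => by simp [hf, mul_left_comm]⟩

/-- The subspace `Ψ H²(𝔻; E)` of `H²(𝔻²)` for a function `Ψ` with values in `𝓑(E, K)`,
`K ⊆ H²(𝔻)`. Here `H²(𝔻²)` is identified with `H²(𝔻; H²(𝔻))` through the variable `z₁`, so that
`Ψ f` is the function `(z₁, z₂) ↦ (Ψ(z₁) f(z₁))(z₂)`. -/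
def bidiscOperatorRange {E : Type u} [NormedAddCommGroup E] [InnerProductSpace ℂ E]
    [CompleteSpace E] {K : Submodule ℂ (HardyDisc ℂ)} (Ψ : ℂ → E →L[ℂ] K) :
    Submodule ℂ HardyBidisc where
  carrier := {H | ∃ f : HardyDisc E, ∀ z w : 𝔻, H (z, w) = (Ψ z (f z) : HardyDisc ℂ) w}
  zero_mem' := ⟨0, fun z w => by simp⟩
  add_mem' := by
    rintro a b ⟨f, hf⟩ ⟨g, hg⟩
    exact ⟨f + g, fun z w => by simp [hf, hg]⟩
  smul_mem' := by
    rintro c a ⟨f, hf⟩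
    exact ⟨c • f, fun z w => by simp [hf]⟩

/-! ### Type I / II subspaces and their lifts -/

/-- The subspace `φ H²(𝔻) ⊕ {0}` of `H²(𝔻) ⊕ ℂ`. -/
def typeOneSubspace (φ : ℂ → ℂ) : Submodule ℂ LowerSpace where
  carrier := {x | x.fst ∈ innerRange φ ∧ x.snd = 0}
  zero_mem' := ⟨zero_mem _, rfl⟩
  add_mem' := by
    rintro a b ⟨ha, ha'⟩ ⟨hb, hb'⟩
    exact ⟨add_mem ha hb, by simp [ha', hb']⟩
  smul_mem' := by
    rintro c a ⟨ha, ha'⟩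
    exact ⟨Submodule.smul_mem _ c ha, by simp [ha']⟩

/-- The line `ℂ (g, 1)` in `H²(𝔻) ⊕ ℂ`. -/
def typeTwoLine (g : HardyDisc ℂ) : Submodule ℂ LowerSpace :=
  Submodule.span ℂ {WithLp.toLp 2 (g, (1 : ℂ))}

/-- `φ` and `g` are the data of a Type II invariant subspace of the Brownian shift with parameters
`σ`, `θ`: the function `φ` is inner, its boundary value `φ(e^{iθ})` exists, and
`g(z) = σ (conj φ(e^{iθ}) φ(z) - 1) / (z - e^{iθ})` is an element of `H²(𝔻)`. -/
def IsTypeTwoData (σ θ : ℝ) (φ : ℂ → ℂ) (g : HardyDisc ℂ) : Prop :=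
  IsScalarInner φ ∧
    ∃ c : ℂ,
      Filter.Tendsto (fun r : ℝ => φ (r * Complex.exp (Complex.I * θ))) (𝓝[<] 1) (𝓝 c) ∧
      ∀ z : 𝔻, g z = σ * ((conj c * φ z - 1) / (z - Complex.exp (Complex.I * θ)))

/-- The subspace `M₀ ⊕ M₁` of `H²(𝔻²) ⊕ (H²(𝔻) ⊕ ℂ)`. -/
def blockSubspace (M₀ : Submodule ℂ HardyBidisc) (M₁ : Submodule ℂ LowerSpace) :
    Submodule ℂ BrownianSpace where
  carrier := {x | x.fst ∈ M₀ ∧ x.snd ∈ M₁}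
  zero_mem' := ⟨zero_mem _, zero_mem _⟩
  add_mem' := fun ha hb => ⟨add_mem ha.1 hb.1, add_mem ha.2 hb.2⟩
  smul_mem' := fun c _ ha => ⟨Submodule.smul_mem _ c ha.1, Submodule.smul_mem _ c ha.2⟩

section Lifted

variable (E : Type u) [NormedAddCommGroup E] [InnerProductSpace ℂ E] [CompleteSpace E]

/-- `M` is a lifted Type I subspace with multiplicity space `E`:
`M = M₀ ⊕ M₁` with `M₁ = φ H²(𝔻) ⊕ {0}` and `M₀ = φ_{z₂} H²(𝔻²) ⊕ Ψ H²(𝔻; E)` (orthogonal sum)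
for some inner functions `φ ∈ H^∞(𝔻)` and `Ψ ∈ H^∞(𝔻; 𝓑(E, K_φ))`. -/
def IsLiftedTypeOne (M : Submodule ℂ BrownianSpace) : Prop :=
  ∃ (φ : ℂ → ℂ) (Ψ : ℂ → E →L[ℂ] ModelSpace φ),
    IsScalarInner φ ∧ IsInner Ψ ∧
    bidiscInnerRange φ ⟂ bidiscOperatorRange Ψ ∧
    M = blockSubspace (bidiscInnerRange φ ⊔ bidiscOperatorRange Ψ) (typeOneSubspace φ)

/-- `M` is a lifted Type II subspace (for the parameters `σ`, `θ`) with multiplicity space `E` and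
function `g`: `M = M₀ ⊕ M₁` with `M₁ = ℂ (g, 1) ⊕ (φ H²(𝔻) ⊕ {0})` and
`M₀ = φ_{z₂} H²(𝔻²) ⊕ g_{z₂} H²_{z₁}(𝔻) ⊕ Ψ H²(𝔻; E)` (orthogonal sums) for some inner functions
`φ ∈ H^∞(𝔻)` and `Ψ ∈ H^∞(𝔻; 𝓑(E, K_φ))` with `Ψ(0) E ⊆ g^⊥`, where `g` is the function
determined by `φ`, `σ` and `θ`. -/
def IsLiftedTypeTwo (σ θ : ℝ) (g : HardyDisc ℂ) (M : Submodule ℂ BrownianSpace) : Prop :=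
  ∃ (φ : ℂ → ℂ) (Ψ : ℂ → E →L[ℂ] ModelSpace φ),
    IsTypeTwoData σ θ φ g ∧ IsInner Ψ ∧
    (∀ e : E, ⟪g, (Ψ 0 e : HardyDisc ℂ)⟫_ℂ = 0) ∧
    typeTwoLine g ⟂ typeOneSubspace φ ∧
    bidiscInnerRange φ ⟂ bidiscTensorRange g ∧
    bidiscInnerRange φ ⟂ bidiscOperatorRange Ψ ∧
    bidiscTensorRange g ⟂ bidiscOperatorRange Ψ ∧
    M = blockSubspace (bidiscInnerRange φ ⊔ bidiscTensorRange g ⊔ bidiscOperatorRange Ψ)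
      (typeTwoLine g ⊔ typeOneSubspace φ)

/-- The (Hilbert space) dimension of `E`: the cardinality of an orthonormal basis. -/
def hilbertDim : Cardinal.{u} :=
  sInf {κ | ∃ s : Set E, Nonempty (HilbertBasis s ℂ E) ∧ Cardinal.mk s = κ}

end Lifted

/-- Unitary equivalence of the restrictions of `T₁`, `T₂` to invariant subspaces `M`, `N`: there is
a unitary `U : M → N` with `U T₁|_M = T₂|_N U`. -/
def RestrictionsUnitarilyEquivalent {H : Type*} [NormedAddCommGroup H] [InnerProductSpace ℂ H]
    (T₁ T₂ : H →L[ℂ] H) (M N : Submodule ℂ H)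
    (hM : ∀ x ∈ M, T₁ x ∈ M) (hN : ∀ x ∈ N, T₂ x ∈ N) : Prop :=
  ∃ U : M ≃ₗᵢ[ℂ] N, ∀ x : M, U ⟨T₁ x, hM x x.2⟩ = ⟨T₂ (U x), hN (U x) (U x).2⟩

end

noncomputable section

/-! Both types are handled by one model. A lifted subspace is parametrized by quintuples `(G, k, u,
h, α)`, and the relation $zg + \sigma = e^{i\theta} g + \sigma\overline{c}\varphi$, with $c$ the
boundary value of $\varphi$, turns the 3-Brownian shift into `liftedModelShift`. The functions
$\varphi$, $\Psi$ and $g$ disappear: operator and norm depend only on $\sigma$, $\omega =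
e^{i\theta}$, $r = \|g\|$, the space $E$ and a flag $s$, which is 0 for Type I and 1 for Type II
(`exists_isLiftedModel`). If these data agree, the two parametrizations induce the same seminorm and
the same operator, so they differ by an intertwining unitary (`IsLiftedModel.exists_unitary`).

Conversely, each of these data can be read off from $T$ and the norm. The defect $D(y) = \|Ty\|^2 -
\|y\|^2$ equals $\sigma^2(\|h\|^2 + s^2(1+r^2)|\alpha|^2)$, and $D(Ty) - D(y) = \sigma^4
s^2|\alpha|^2$. Hence: - $\sigma^2$ is the largest value of $D$ on unit vectors; - $s = 0$ exactly
when the second difference vanishes identically; - for $s = 1$, $1 + r^2$ is the least squared norm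
of a vector with $|\alpha| = 1$, and $T$ acts as $\omega$ modulo the vectors with $\alpha = 0$; -
$E$ is the space of vectors with $D(y) = 0$ that are orthogonal to the range of $T$
(`wandering_iff`). -/

theorem lpTwo_mem {ι E : Type*} [NormedAddCommGroup E] {a : ι → E}
    (ha : Summable fun i => ‖a i‖ ^ 2) : Memℓp a 2 :=
  memℓp_gen (by simpa using ha)

theorem lpTwo_norm_sq {ι E : Type*} [NormedAddCommGroup E] (a : lp (fun _ : ι => E) 2) :
    ‖a‖ ^ 2 = ∑' i, ‖a i‖ ^ 2 := by
  simpa using lp.norm_rpow_eq_tsum (p := 2) (by simp) a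

/-! ### Vector-valued Hardy spaces: coefficients, shift, constants -/

namespace HardyDisc

section

variable {E : Type u} [NormedAddCommGroup E] [InnerProductSpace ℂ E] [CompleteSpace E]
variable {F : Type v} [NormedAddCommGroup F] [InnerProductSpace ℂ F] [CompleteSpace F]

theorem summable_norm_sq_coeff (f : HardyDisc E) : Summable fun n => ‖coeff E f n‖ ^ 2 :=
  lpTwo_summable_sq _

theorem norm_sq_eq_tsum (f : HardyDisc E) : ‖f‖ ^ 2 = ∑' n, ‖coeff E f n‖ ^ 2 := by
  rw [← (coeff E).norm_map, lpTwo_norm_sq]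

theorem exists_coeff_eq {a : ℕ → E} (ha : Summable fun n => ‖a n‖ ^ 2) :
    ∃ f : HardyDisc E, ∀ n, coeff E f n = a n :=
  ⟨(coeff E).symm ⟨a, lpTwo_mem ha⟩, fun n => by rw [LinearIsometryEquiv.apply_symm_apply]⟩

theorem coeff_zero (f : HardyDisc E) : coeff E f 0 = f 0 := by
  have h := hasSum_single (f := fun n : ℕ => ((0 : 𝔻) : ℂ) ^ n • coeff E f n) 0 fun n hn => by
    simp [hn]
  have h' := (f.hasSum_coeff 0).unique h
  simpa using h'.symm

theorem hasSum_inner (f g : HardyDisc E) :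
    HasSum (fun n => ⟪coeff E f n, coeff E g n⟫_ℂ) ⟪f, g⟫_ℂ := by
  rw [← (coeff E).inner_map_map]
  exact lp.hasSum_inner _ _

variable (E) in
theorem exists_shift (f : HardyDisc E) :
    ∃ h : HardyDisc E, h.1 = (fun z : 𝔻 => (z : ℂ) • f z) ∧ ‖h‖ = ‖f‖ := by
  obtain ⟨b, hb, hb0, hn⟩ := lpTwo_exists_extend Nat.succ_injective (coeff E f)
  obtain ⟨h, hh, hhn⟩ := exists_of_hasSum (F := fun z : 𝔻 => (z : ℂ) • f z) b fun z => by
    rw [← Function.Injective.hasSum_iff Nat.succ_injective fun k hk => by rw [hb0 k hk, smul_zero]]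
    refine ((f.hasSum_coeff z).const_smul (z : ℂ)).congr_fun ?_
    intro n
    simp only [Function.comp_apply, hb, smul_smul, Nat.succ_eq_add_one, pow_succ']
  exact ⟨h, hh, by rw [hhn, hn, LinearIsometryEquiv.norm_map]⟩

variable (E) in
/-- The shift `f ↦ z f` on `H²(𝔻; E)`. -/
def shift : HardyDisc E →ₗᵢ[ℂ] HardyDisc E where
  toFun f := ⟨fun z => (z : ℂ) • f z, by
    obtain ⟨h, hh, -⟩ := exists_shift E f
    exact hh ▸ h.2⟩
  map_add' f g := ext fun z => smul_add (z : ℂ) (f z) (g z)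
  map_smul' c f := ext fun z => smul_comm (z : ℂ) c (f z)
  norm_map' f := by
    obtain ⟨h, hh, hn⟩ := exists_shift E f
    rw [← hn]
    exact congrArg norm (Subtype.ext hh.symm)

@[simp] theorem shift_apply (f : HardyDisc E) (z : 𝔻) : shift E f z = (z : ℂ) • f z := rfl

theorem exists_const (c : E) :
    ∃ h : HardyDisc E, h.1 = (fun _ : 𝔻 => c) ∧ ‖h‖ = ‖c‖ := by
  obtain ⟨h, hh, hhn⟩ := exists_of_hasSum (F := fun _ : 𝔻 => c)
    (lp.single 2 (0 : ℕ) c) fun z => by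
      have h := hasSum_single (f := fun n : ℕ => (z : ℂ) ^ n •
        (lp.single 2 (0 : ℕ) c : lp (fun _ : ℕ => E) 2) n) 0 fun n hn => by
          rw [lp.single_apply_ne _ _ _ hn, smul_zero]
      rwa [pow_zero, one_smul, lp.single_apply_self] at h
  exact ⟨h, hh, by rw [hhn, lp.norm_single (by simp)]⟩

variable (E) in
/-- The embedding of `E` into `H²(𝔻; E)` as the constant functions. -/
def const : E →ₗᵢ[ℂ] HardyDisc E where
  toFun c := ⟨fun _ => c, by
    obtain ⟨h, hh, -⟩ := exists_const c
    exact hh ▸ h.2⟩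
  map_add' _ _ := rfl
  map_smul' _ _ := rfl
  norm_map' c := by
    obtain ⟨h, hh, hn⟩ := exists_const c
    rw [← hn]
    exact congrArg norm (Subtype.ext hh.symm)

@[simp] theorem const_apply (c : E) (z : 𝔻) : const E c z = c := rfl

theorem coeff_const_of_ne (c : E) {n : ℕ} (hn : n ≠ 0) : coeff E (const E c) n = 0 := by
  have h : const E c = (coeff E).symm (lp.single 2 (0 : ℕ) c) := by
    refine ext fun z => ?_
    refine HasSum.unique ?_ (hasSum_coeff _ z)
    rw [LinearIsometryEquiv.apply_symm_apply]
    have h := hasSum_single (f := fun n : ℕ => (z : ℂ) ^ n •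
      (lp.single 2 (0 : ℕ) c : lp (fun _ : ℕ => E) 2) n) 0 fun n hn => by
        rw [lp.single_apply_ne _ _ _ hn, smul_zero]
    rwa [pow_zero, one_smul, lp.single_apply_self] at h
  rw [h, LinearIsometryEquiv.apply_symm_apply, lp.single_apply_ne _ _ _ hn]

theorem inner_const (c : E) (f : HardyDisc E) : ⟪const E c, f⟫_ℂ = ⟪c, f 0⟫_ℂ := by
  have h := hasSum_single (f := fun n : ℕ => ⟪coeff E (const E c) n, coeff E f n⟫_ℂ) 0
    fun n hn => by rw [coeff_const_of_ne c hn, inner_zero_left]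
  rw [coeff_zero, coeff_zero, const_apply] at h
  exact (hasSum_inner _ _).unique h

theorem inner_const_shift (c : E) (f : HardyDisc E) : ⟪const E c, shift E f⟫_ℂ = 0 := by
  simp [inner_const]

/-- Here `g` is the backward shift of `f`. Together with `inner_const_shift` this is the splitting
of the Hardy space into constants and the range of the shift. -/
theorem exists_eq_const_add_shift (f : HardyDisc E) :
    ∃ g : HardyDisc E, f = const E (f 0) + shift E g := by
  obtain ⟨g, hg⟩ := exists_coeff_eq (E := E) (a := fun n => coeff E f (n + 1))
    ((summable_nat_add_iff 1).2 f.summable_norm_sq_coeff)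
  refine ⟨g, ext fun z => ?_⟩
  have h1 := (hasSum_nat_add_iff' 1).2 (f.hasSum_coeff z)
  have h2 := (g.hasSum_coeff z).const_smul (z : ℂ)
  simp only [hg, smul_smul, ← pow_succ'] at h2
  have h3 := h1.unique h2
  simp only [Finset.range_one, Finset.sum_singleton, pow_zero, one_smul, coeff_zero] at h3
  simp [← h3]

/-- The operator is applied to each Taylor coefficient. The scale `C` serves two cases: an isometry
(`C = 1`) and the map $c \mapsto c\,g$ (`C = ‖g‖`, possibly zero). -/
theorem exists_map (V : E →L[ℂ] F) {C : ℝ} (hC : 0 ≤ C) (hV : ∀ x, ‖V x‖ = C * ‖x‖)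
    (f : HardyDisc E) : ∃ h : HardyDisc F, (∀ z, h z = V (f z)) ∧ ‖h‖ = C * ‖f‖ := by
  have he : ∀ n, ‖V (coeff E f n)‖ ^ 2 = C ^ 2 * ‖coeff E f n‖ ^ 2 := fun n => by rw [hV, mul_pow]
  obtain ⟨h, hh⟩ := exists_coeff_eq (E := F) (a := fun n => V (coeff E f n))
    (by simpa only [he] using f.summable_norm_sq_coeff.mul_left (C ^ 2))
  refine ⟨h, fun z => ?_, ?_⟩
  · have h1 := V.hasSum (f.hasSum_coeff z)
    simp only [map_smul, ← hh] at h1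
    exact (h.hasSum_coeff z).unique h1
  · rw [← sq_eq_sq₀ (norm_nonneg _) (by positivity), mul_pow, norm_sq_eq_tsum, norm_sq_eq_tsum,
      ← tsum_mul_left]
    simp only [hh, he]

/-- The operator `f ↦ V ∘ f` for an isometry `V`. -/
def mapIsometry (V : E →ₗᵢ[ℂ] F) : HardyDisc E →ₗᵢ[ℂ] HardyDisc F where
  toFun f := ⟨fun z => V (f z), by
    obtain ⟨h, hh, -⟩ := exists_map V.toContinuousLinearMap zero_le_one (by simp) f
    have : h.1 = fun z => V (f z) := funext hh
    exact this ▸ h.2⟩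
  map_add' f g := ext fun z => map_add V (f z) (g z)
  map_smul' c f := ext fun z => map_smul V c (f z)
  norm_map' f := by
    obtain ⟨h, hh, hn⟩ := exists_map V.toContinuousLinearMap zero_le_one (by simp) f
    rw [one_mul] at hn
    rw [← hn]
    exact congrArg norm (ext fun z => (hh z).symm)

@[simp] theorem mapIsometry_apply (V : E →ₗᵢ[ℂ] F) (f : HardyDisc E) (z : 𝔻) :
    mapIsometry V f z = V (f z) := rfl

end

theorem hardyShift_eq (f : HardyDisc ℂ) : hardyShift f = shift ℂ f := rfl

theorem hardyConst_eq (c : ℂ) : hardyConst c = const ℂ c := rfl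

@[simp] theorem hardyShift_apply (f : HardyDisc ℂ) (z : 𝔻) : hardyShift f z = z * f z := rfl

@[simp] theorem hardyConst_apply (c : ℂ) (z : 𝔻) : hardyConst c z = c := rfl

/-- Point evaluation is given by the inner product with the Szegő kernel. -/
theorem exists_szegoKernel (w : 𝔻) : ∃ k : HardyDisc ℂ, ∀ f : HardyDisc ℂ, ⟪k, f⟫_ℂ = f w := by
  -- These are the Taylor coefficients of $1/(1 - \overline{w}z)$.
  obtain ⟨k, hk⟩ := exists_coeff_eq (E := ℂ) (a := fun n => conj ((w : ℂ) ^ n))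
    (by simpa using unitDisc_summable_sq w)
  refine ⟨k, fun f => (hasSum_inner k f).unique ?_⟩
  refine (f.hasSum_coeff w).congr_fun fun n => ?_
  simp [hk, mul_comm]

end HardyDisc

/-! ### The bidisc Hardy space as a space of vector-valued functions of the first variable -/

namespace HardyBidisc

theorem norm_sq_eq_tsum (F : HardyBidisc) : ‖F‖ ^ 2 = ∑' k, ‖coeff F k‖ ^ 2 := by
  rw [← coeff.norm_map, lpTwo_norm_sq]

/-- Evaluation at `w` is a continuous functional on the Hardy space, so it passes through the
vector-valued power series in the first variable. The norms agree by summing the double family row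
by row. -/
theorem eq_of_coeff_eq {f : HardyDisc (HardyDisc ℂ)} {G : HardyBidisc}
    (h : ∀ m n, HardyDisc.coeff ℂ (HardyDisc.coeff _ f m) n = coeff G (m, n)) :
    (∀ z w, G (z, w) = f z w) ∧ ‖G‖ = ‖f‖ := by
  constructor
  · intro z w
    obtain ⟨k, hk⟩ := HardyDisc.exists_szegoKernel w
    have h1 := (innerSL ℂ k).hasSum (f.hasSum_coeff z)
    simp only [map_smul, innerSL_apply_apply, hk] at h1
    refine HasSum.unique ((G.hasSum_coeff (z, w)).prod_fiberwise fun m => ?_) h1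
    refine (((HardyDisc.coeff _ f m).hasSum_coeff w).const_smul ((z : ℂ) ^ m)).congr_fun fun n => ?_
    simp [h, mul_assoc]
  · rw [← sq_eq_sq₀ (norm_nonneg _) (norm_nonneg _), norm_sq_eq_tsum, HardyDisc.norm_sq_eq_tsum,
      (lpTwo_summable_sq (coeff G)).tsum_prod]
    simp only [HardyDisc.norm_sq_eq_tsum, h]

theorem exists_of_hardyDisc (f : HardyDisc (HardyDisc ℂ)) :
    ∃ G : HardyBidisc, (∀ z w, G (z, w) = f z w) ∧ ‖G‖ = ‖f‖ := by
  obtain ⟨a, ha⟩ : ∃ a : ℕ × ℕ → ℂ,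
      ∀ m n, a (m, n) = HardyDisc.coeff ℂ (HardyDisc.coeff _ f m) n :=
    ⟨fun k => HardyDisc.coeff ℂ (HardyDisc.coeff _ f k.1) k.2, fun _ _ => rfl⟩
  have hs : Summable fun k => ‖a k‖ ^ 2 := by
    refine (summable_prod_of_nonneg fun _ => by positivity).2 ⟨fun m => ?_, ?_⟩
    · simpa only [ha] using HardyDisc.summable_norm_sq_coeff (HardyDisc.coeff _ f m)
    · simpa only [ha, ← HardyDisc.norm_sq_eq_tsum] using f.summable_norm_sq_coeff
  refine ⟨coeff.symm ⟨a, lpTwo_mem hs⟩, eq_of_coeff_eq fun m n => ?_⟩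
  rw [LinearIsometryEquiv.apply_symm_apply, ← ha]

theorem exists_hardyDisc (G : HardyBidisc) :
    ∃ f : HardyDisc (HardyDisc ℂ), ∀ z w, G (z, w) = f z w := by
  have hs := (summable_prod_of_nonneg fun _ => by positivity).1 (lpTwo_summable_sq (coeff G))
  choose a ha using fun m => HardyDisc.exists_coeff_eq (E := ℂ) (a := fun n => coeff G (m, n))
    (hs.1 m)
  obtain ⟨f, hf⟩ := HardyDisc.exists_coeff_eq (E := HardyDisc ℂ) (a := a)
    (by simpa only [HardyDisc.norm_sq_eq_tsum, ha] using hs.2)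
  exact ⟨f, (eq_of_coeff_eq fun m n => by rw [hf, ha]).1⟩

/-- The identification of `H²(𝔻; H²(𝔻))` with `H²(𝔻²)` through the first variable. -/
def ofHardyDisc : HardyDisc (HardyDisc ℂ) ≃ₗᵢ[ℂ] HardyBidisc :=
  LinearIsometryEquiv.ofSurjective
    { toFun := fun f => ⟨fun p => f p.1 p.2, by
        obtain ⟨h, hh, -⟩ := exists_of_hardyDisc f
        have : h.1 = fun p : 𝔻 × 𝔻 => f p.1 p.2 := funext fun p => hh p.1 p.2
        exact this ▸ h.2⟩
      map_add' := fun _ _ => rfl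
      map_smul' := fun _ _ => rfl
      norm_map' := fun f => by
        obtain ⟨h, hh, hn⟩ := exists_of_hardyDisc f
        rw [← hn]
        exact congrArg norm (ext fun p => (hh p.1 p.2).symm) }
    fun G => by
      obtain ⟨f, hf⟩ := exists_hardyDisc G
      exact ⟨f, ext fun p => (hf p.1 p.2).symm⟩

@[simp] theorem ofHardyDisc_apply (f : HardyDisc (HardyDisc ℂ)) (z w : 𝔻) :
    ofHardyDisc f (z, w) = f z w := rfl

@[simp] theorem bidiscShift_apply (F : HardyBidisc) (z w : 𝔻) :
    bidiscShift F (z, w) = z * F (z, w) := rfl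

@[simp] theorem bidiscEmbed_apply (f : HardyDisc ℂ) (z w : 𝔻) :
    bidiscEmbed f (z, w) = f w := rfl

theorem ofHardyDisc_shift (f : HardyDisc (HardyDisc ℂ)) :
    ofHardyDisc (HardyDisc.shift _ f) = bidiscShift (ofHardyDisc f) := rfl

theorem ofHardyDisc_const (f : HardyDisc ℂ) :
    ofHardyDisc (HardyDisc.const _ f) = bidiscEmbed f := rfl

theorem inner_bidiscEmbed_bidiscShift (f : HardyDisc ℂ) (F : HardyBidisc) :
    ⟪bidiscEmbed f, bidiscShift F⟫_ℂ = 0 := by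
  obtain ⟨F, rfl⟩ := ofHardyDisc.surjective F
  rw [← ofHardyDisc_shift, ← ofHardyDisc_const, LinearIsometryEquiv.inner_map_map,
    HardyDisc.inner_const_shift]

theorem exists_eq_bidiscEmbed_add_bidiscShift (F : HardyBidisc) :
    ∃ (f : HardyDisc ℂ) (G : HardyBidisc), F = bidiscEmbed f + bidiscShift G := by
  obtain ⟨F, rfl⟩ := ofHardyDisc.surjective F
  obtain ⟨G, hG⟩ := F.exists_eq_const_add_shift
  refine ⟨F 0, ofHardyDisc G, ?_⟩
  rw [← ofHardyDisc_shift, ← ofHardyDisc_const, ← map_add, ← hG]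

end HardyBidisc

/-! ### Orthogonal sums and unitaries induced by equal seminorms -/

theorem norm_sq_add_smul_of_inner_eq_zero {H : Type*} [NormedAddCommGroup H]
    [InnerProductSpace ℂ H] {x y : H} (h : ⟪y, x⟫_ℂ = 0) (c : ℂ) :
    ‖x + c • y‖ ^ 2 = ‖x‖ ^ 2 + ‖c‖ ^ 2 * ‖y‖ ^ 2 := by
  have h' : ⟪x, c • y⟫_ℂ = 0 := by rw [inner_smul_right, inner_eq_zero_symm.1 h, mul_zero]
  have := norm_add_sq_eq_norm_sq_add_norm_sq_of_inner_eq_zero x (c • y) h'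
  rw [norm_smul] at this
  linear_combination this

/-- A surjection determines, up to a unitary, any other surjection with the same seminorm. -/
theorem exists_unitary_of_norm_eq {X K L : Type*} [AddCommGroup X] [Module ℂ X]
    [NormedAddCommGroup K] [InnerProductSpace ℂ K] [NormedAddCommGroup L] [InnerProductSpace ℂ L]
    {A : X →ₗ[ℂ] K} {B : X →ₗ[ℂ] L} (hA : Function.Surjective A) (hB : Function.Surjective B)
    (h : ∀ x, ‖A x‖ = ‖B x‖) : ∃ U : K ≃ₗᵢ[ℂ] L, ∀ x, U (A x) = B x := by
  -- Equal seminorms have equal kernels, so sending `A x` to `B x` is well defined.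
  have key : ∀ x y, A x = A y → B x = B y := fun x y hxy => by
    have := h (x - y)
    rw [map_sub, hxy, sub_self, norm_zero, map_sub] at this
    exact sub_eq_zero.1 (norm_eq_zero.1 this.symm)
  choose f hf using hA
  refine ⟨LinearIsometryEquiv.ofSurjective
    { toFun := fun y => B (f y)
      map_add' := fun y z => by rw [← map_add]; exact key _ _ (by simp [hf])
      map_smul' := fun c y => by
        rw [RingHom.id_apply, ← map_smul]; exact key _ _ (by simp [hf])
      norm_map' := fun y => by
        change ‖B (f y)‖ = ‖y‖
        rw [← h, hf] } fun z => ?_, fun x => key _ _ (hf _)⟩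
  obtain ⟨x, rfl⟩ := hB z
  exact ⟨A x, key _ _ (hf _)⟩

theorem HardyDisc.norm_sq_hardyShift_add (k : HardyDisc ℂ) (c α : ℂ) :
    ‖hardyShift k + c • hardyConst α‖ ^ 2 = ‖k‖ ^ 2 + ‖c‖ ^ 2 * ‖α‖ ^ 2 := by
  rw [norm_sq_add_smul_of_inner_eq_zero, hardyShift.norm_map, hardyConst.norm_map]
  exact HardyDisc.inner_const_shift _ _

theorem HardyBidisc.norm_sq_bidiscShift_add (G : HardyBidisc) (c : ℂ) (h : HardyDisc ℂ) :
    ‖bidiscShift G + c • bidiscEmbed h‖ ^ 2 = ‖G‖ ^ 2 + ‖c‖ ^ 2 * ‖h‖ ^ 2 := by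
  rw [norm_sq_add_smul_of_inner_eq_zero, bidiscShift.norm_map, bidiscEmbed.norm_map]
  exact HardyBidisc.inner_bidiscEmbed_bidiscShift _ _

/-! ### The model operator and its unitary invariants -/

section Model

variable (E : Type u) [NormedAddCommGroup E] [InnerProductSpace ℂ E] [CompleteSpace E]

/-- The parameter space of a lifted subspace: a quintuple `(G, k, u, h, α)` stands for
`(φ_{z₂} G + g_{z₂} k + Ψ u, α g + φ h, α)`. -/
abbrev LiftedModelSpace : Type u :=
  HardyBidisc × HardyDisc ℂ × HardyDisc E × HardyDisc ℂ × ℂ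

variable {E}

/-- The operator on the parameter space which corresponds to the 3-Brownian shift. -/
def liftedModelShift (σ : ℝ) (ω : ℂ) (s : ℝ) (x : LiftedModelSpace E) : LiftedModelSpace E :=
  (bidiscShift x.1 + (σ : ℂ) • bidiscEmbed x.2.2.2.1,
    hardyShift x.2.1 + (s * σ : ℂ) • hardyConst x.2.2.2.2,
    HardyDisc.shift E x.2.2.1,
    hardyShift x.2.2.2.1 + (s * σ : ℂ) • hardyConst x.2.2.2.2,
    ω * x.2.2.2.2)

/-- `A` parametrizes the space `K` in such a way that `T` becomes the model operator. The flag `s`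
is `0` for lifted Type I and `1` for lifted Type II, and `r` is the norm of the function `g`. -/
structure IsLiftedModel {K : Type*} [NormedAddCommGroup K] [InnerProductSpace ℂ K]
    (σ : ℝ) (ω : ℂ) (r s : ℝ) (T : K → K) (A : LiftedModelSpace E →ₗ[ℂ] K) : Prop where
  norm_omega : ‖ω‖ = 1
  flag : s = 0 ∧ r = 0 ∨ s = 1
  surjective : Function.Surjective A
  inner_map : ∀ x y, ⟪A x, A y⟫_ℂ = ⟪x.1, y.1⟫_ℂ + r ^ 2 * ⟪x.2.1, y.2.1⟫_ℂ +
    ⟪x.2.2.1, y.2.2.1⟫_ℂ + ⟪x.2.2.2.1, y.2.2.2.1⟫_ℂ +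
    s ^ 2 * (1 + r ^ 2) * ⟪x.2.2.2.2, y.2.2.2.2⟫_ℂ
  map_shift : ∀ x, T (A x) = A (liftedModelShift σ ω s x)

namespace IsLiftedModel

variable {E' : Type v} [NormedAddCommGroup E'] [InnerProductSpace ℂ E'] [CompleteSpace E']
variable {K : Type*} [NormedAddCommGroup K] [InnerProductSpace ℂ K]
variable {L : Type*} [NormedAddCommGroup L] [InnerProductSpace ℂ L]
variable {σ r s σ' r' s' : ℝ} {ω ω' : ℂ} {T : K → K} {T' : L → L}
variable {A : LiftedModelSpace E →ₗ[ℂ] K} {B : LiftedModelSpace E' →ₗ[ℂ] L}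

theorem norm_sq_map (hA : IsLiftedModel σ ω r s T A) (x : LiftedModelSpace E) :
    ‖A x‖ ^ 2 = ‖x.1‖ ^ 2 + r ^ 2 * ‖x.2.1‖ ^ 2 + ‖x.2.2.1‖ ^ 2 + ‖x.2.2.2.1‖ ^ 2 +
      s ^ 2 * (1 + r ^ 2) * ‖x.2.2.2.2‖ ^ 2 := by
  have h := hA.inner_map x x
  simp only [inner_self_eq_norm_sq_to_K, Complex.coe_algebraMap] at h
  exact_mod_cast h

/-- In each coordinate the shifted term is orthogonal to the term fed in from below, so squared
norms add. The gain is $\sigma^2\|h\|^2$ in the first coordinate, and $r^2 s^2\sigma^2|\alpha|^2$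
and $s^2\sigma^2|\alpha|^2$ in the second and fourth. -/
theorem norm_sq_map_sub (hA : IsLiftedModel σ ω r s T A) (x : LiftedModelSpace E) :
    ‖T (A x)‖ ^ 2 - ‖A x‖ ^ 2 =
      σ ^ 2 * (‖x.2.2.2.1‖ ^ 2 + s ^ 2 * (1 + r ^ 2) * ‖x.2.2.2.2‖ ^ 2) := by
  rw [hA.map_shift, hA.norm_sq_map, hA.norm_sq_map]
  simp only [liftedModelShift, HardyDisc.norm_sq_hardyShift_add,
    HardyBidisc.norm_sq_bidiscShift_add, norm_mul, hA.norm_omega, LinearIsometry.norm_map,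
    Complex.norm_real, mul_pow, Real.norm_eq_abs, sq_abs, one_mul]
  ring

/-- One application of the operator adds $s^2\sigma^2|\alpha|^2$ to $\|h\|^2$ and keeps $|\alpha|$.
This isolates the last coordinate by means of norms only. -/
theorem norm_sq_map_sub_sub (hA : IsLiftedModel σ ω r s T A) (x : LiftedModelSpace E) :
    ‖T (T (A x))‖ ^ 2 - ‖T (A x)‖ ^ 2 - (‖T (A x)‖ ^ 2 - ‖A x‖ ^ 2) =
      σ ^ 4 * s ^ 2 * ‖x.2.2.2.2‖ ^ 2 := by
  rw [hA.norm_sq_map_sub, hA.map_shift, hA.norm_sq_map_sub]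
  simp only [liftedModelShift, HardyDisc.norm_sq_hardyShift_add, norm_mul, hA.norm_omega,
    Complex.norm_real, mul_pow, Real.norm_eq_abs, sq_abs, one_mul]
  ring

/-- The left side uses only `T` and the inner product, so it is preserved by an intertwining
unitary. Vanishing defect removes `h` and the visible part of `α`; orthogonality to the range of `T`
then removes everything except the constant term of `u`. -/
theorem wandering_iff (hA : IsLiftedModel σ ω r s T A) (hσ : σ ≠ 0) (y : K) :
    (‖T y‖ ^ 2 - ‖y‖ ^ 2 = 0 ∧ ∀ x, ⟪y, T x⟫_ℂ = 0) ↔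
      ∃ e : E, A (0, 0, HardyDisc.const E e, 0, 0) = y := by
  constructor
  · rintro ⟨h0, h1⟩
    obtain ⟨⟨G, k, u, h, α⟩, rfl⟩ := hA.surjective y
    rw [hA.norm_sq_map_sub] at h0
    have h2 : ‖h‖ ^ 2 + s ^ 2 * (1 + r ^ 2) * ‖α‖ ^ 2 = 0 := by
      simpa [hσ] using h0
    have hh : ‖h‖ ^ 2 = 0 := by
      have : 0 ≤ s ^ 2 * (1 + r ^ 2) * ‖α‖ ^ 2 := by positivity
      nlinarith [sq_nonneg ‖h‖]
    have hα : s ^ 2 * (1 + r ^ 2) * ‖α‖ ^ 2 = 0 := by rwa [hh, zero_add] at h2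
    have hh' : h = 0 := by simpa using hh
    have hα' : (s ^ 2 * (1 + r ^ 2) : ℂ) * conj α = 0 := by
      have : s ^ 2 * (1 + r ^ 2) = 0 ∨ α = 0 := by simpa using hα
      rcases this with h | h
      · rw [show (s ^ 2 * (1 + r ^ 2) : ℂ) = ((s ^ 2 * (1 + r ^ 2) : ℝ) : ℂ) by push_cast; rfl, h]
        simp
      · simp [h]
    -- With `h` and the `α` term gone, orthogonality to the range of `T` concerns three coordinates
    -- only, and the test vectors are free.
    have h3 : ∀ G' k' u' h' α', ⟪G, bidiscShift G' + (σ : ℂ) • bidiscEmbed h'⟫_ℂ +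
        r ^ 2 * ⟪k, hardyShift k' + (s * σ : ℂ) • hardyConst α'⟫_ℂ +
        ⟪u, HardyDisc.shift E u'⟫_ℂ = 0 := fun G' k' u' h' α' => by
      have := h1 (A (G', k', u', h', α'))
      rw [hA.map_shift, hA.inner_map] at this
      simp only [liftedModelShift, hh', inner_zero_left, add_zero, RCLike.inner_apply] at this
      linear_combination this - ω * α' * hα'
    -- The first coordinates of the range fill the whole bidisc space: the part of `G` that depends
    -- on the second variable alone is reached through $\sigma h'$. So `G` is orthogonal to itself.
    have hG : G = 0 := by
      obtain ⟨f, G', hG'⟩ := G.exists_eq_bidiscEmbed_add_bidiscShift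
      have := h3 G' 0 0 ((σ : ℂ)⁻¹ • f) 0
      have hσ' : (σ : ℂ) ≠ 0 := by exact_mod_cast hσ
      rw [map_smul, smul_smul, mul_inv_cancel₀ hσ', one_smul, add_comm (bidiscShift G'),
        ← hG'] at this
      simpa using this
    -- For $s = 1$ the constant `k 0` is reached through $\sigma\alpha'$. For $s = 0$ the weight $r$
    -- vanishes and nothing is claimed about `k`.
    have hk : (r : ℂ) ^ 2 * ⟪k, k⟫_ℂ = 0 := by
      rcases hA.flag with ⟨-, hr⟩ | hs
      · simp [hr]
      · obtain ⟨k', hk'⟩ := k.exists_eq_const_add_shift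
        have := h3 0 k' 0 0 ((σ : ℂ)⁻¹ * k 0)
        have hσ' : (σ : ℂ) ≠ 0 := by exact_mod_cast hσ
        rw [hs, Complex.ofReal_one, one_mul, ← map_smul hardyConst, smul_eq_mul,
          mul_inv_cancel_left₀ hσ', HardyDisc.hardyShift_eq, HardyDisc.hardyConst_eq,
          add_comm (HardyDisc.shift _ k'), ← hk'] at this
        simpa using this
    -- Nothing feeds into the third coordinate, so its range is that of the shift alone and the
    -- constants survive.
    have hu : ∃ e, u = HardyDisc.const E e := by
      obtain ⟨u', hu'⟩ := u.exists_eq_const_add_shift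
      have := h3 0 0 u' 0 0
      simp only [map_zero, smul_zero, add_zero, inner_zero_right, mul_zero, zero_add] at this
      rw [hu', inner_add_left, HardyDisc.inner_const_shift, zero_add, inner_self_eq_zero] at this
      exact ⟨u 0, by rw [this, add_zero] at hu'; exact hu'⟩
    obtain ⟨e, rfl⟩ := hu
    refine ⟨e, ?_⟩
    -- The quintuples themselves need not agree, since `A` may have a kernel; the difference of
    -- their images has norm zero.
    rw [← sub_eq_zero, ← map_sub, ← norm_eq_zero, ← sq_eq_zero_iff, hA.norm_sq_map]
    have hk' : r ^ 2 * ‖k‖ ^ 2 = 0 := by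
      rw [inner_self_eq_norm_sq_to_K] at hk
      exact Complex.ofReal_injective (by push_cast; exact hk)
    simp [hG, hk', hh', hα]
  · rintro ⟨e, rfl⟩
    refine ⟨by simp [hA.norm_sq_map_sub], fun x => ?_⟩
    obtain ⟨x, rfl⟩ := hA.surjective x
    rw [hA.map_shift, hA.inner_map]
    simp [liftedModelShift, HardyDisc.inner_const_shift]

/-- The copy of the multiplicity space inside `K`. -/
def multiplicityEmbedding (hA : IsLiftedModel σ ω r s T A) : E →ₗᵢ[ℂ] K where
  toLinearMap := A ∘ₗ LinearMap.inr ℂ HardyBidisc _ ∘ₗ LinearMap.inr ℂ (HardyDisc ℂ) _ ∘ₗ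
    LinearMap.inl ℂ (HardyDisc E) (HardyDisc ℂ × ℂ) ∘ₗ (HardyDisc.const E).toLinearMap
  norm_map' e := by
    rw [← sq_eq_sq₀ (norm_nonneg _) (norm_nonneg _)]
    simp [hA.norm_sq_map]

theorem mem_range_multiplicityEmbedding (hA : IsLiftedModel σ ω r s T A) (hσ : σ ≠ 0) (y : K) :
    y ∈ LinearMap.range hA.multiplicityEmbedding.toLinearMap ↔
      ‖T y‖ ^ 2 - ‖y‖ ^ 2 = 0 ∧ ∀ x, ⟪y, T x⟫_ℂ = 0 :=
  (hA.wandering_iff hσ y).symm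

variable {U : K ≃ₗᵢ[ℂ] L}

theorem nonempty_multiplicity_equiv (hA : IsLiftedModel σ ω r s T A)
    (hB : IsLiftedModel σ' ω' r' s' T' B) (hσ : σ ≠ 0) (hσ' : σ' ≠ 0)
    (hU : ∀ x, U (T x) = T' (U x)) : Nonempty (E ≃ₗᵢ[ℂ] E') := by
  have h : (LinearMap.range hA.multiplicityEmbedding.toLinearMap).map
      (U.toLinearEquiv : K →ₗ[ℂ] L) = LinearMap.range hB.multiplicityEmbedding.toLinearMap := by
    ext y
    obtain ⟨x, rfl⟩ := U.surjective y
    rw [hB.mem_range_multiplicityEmbedding hσ', ← hU, U.norm_map, U.norm_map, U.surjective.forall]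
    simp only [← hU, U.inner_map_map]
    rw [← hA.mem_range_multiplicityEmbedding hσ]
    constructor
    · rintro ⟨z, hz, hzx⟩
      rwa [← U.injective hzx]
    · exact fun hx => ⟨x, hx, rfl⟩
  exact ⟨hA.multiplicityEmbedding.equivRange.trans <| (U.submoduleMap _).trans <|
    (LinearIsometryEquiv.ofEq _ _ h).trans hB.multiplicityEmbedding.equivRange.symm⟩

/-- The defect of a vector is at most $\sigma'^2$ times its squared norm in the second model, while
the constant function 1 in the fourth coordinate attains $\sigma^2$ in the first. -/
theorem sigma_le (hA : IsLiftedModel σ ω r s T A)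
    (hB : IsLiftedModel σ' ω' r' s' T' B) (hσ' : 0 ≤ σ')
    (hU : ∀ x, U (T x) = T' (U x)) : σ ≤ σ' := by
  have h1 := hA.norm_sq_map_sub (0, 0, 0, hardyConst 1, 0)
  have h2 := hA.norm_sq_map (0, 0, 0, hardyConst 1, 0)
  obtain ⟨x, hx⟩ := hB.surjective (U (A (0, 0, 0, hardyConst 1, 0)))
  rw [← U.norm_map, ← U.norm_map (A _), hU, ← hx, hB.norm_sq_map_sub] at h1
  rw [← U.norm_map, ← hx, hB.norm_sq_map] at h2
  simp only [norm_zero, LinearIsometry.norm_map, norm_one] at h1 h2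
  refine abs_le_of_sq_le_sq' (a := σ) (b := σ') ?_ hσ' |>.2
  have : 0 ≤ ‖x.1‖ ^ 2 + r' ^ 2 * ‖x.2.1‖ ^ 2 + ‖x.2.2.1‖ ^ 2 := by positivity
  nlinarith [sq_nonneg σ']

/-- The second difference of $\|T^n y\|^2$ is preserved by an intertwining unitary, and $\sigma > 0$
can be cancelled. -/
theorem norm_last_eq (hA : IsLiftedModel σ ω r s T A) (hB : IsLiftedModel σ ω' r' s' T' B)
    (hσ : 0 < σ) (hU : ∀ x, U (T x) = T' (U x)) {x : LiftedModelSpace E}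
    {y : LiftedModelSpace E'} (h : U (A x) = B y) :
    s ^ 2 * ‖x.2.2.2.2‖ ^ 2 = s' ^ 2 * ‖y.2.2.2.2‖ ^ 2 := by
  have h1 := hA.norm_sq_map_sub_sub x
  have h2 := hB.norm_sq_map_sub_sub y
  rw [← h, ← hU, ← hU, U.norm_map, U.norm_map, U.norm_map, h1, mul_assoc, mul_assoc] at h2
  exact mul_left_cancel₀ (by positivity) h2

theorem flag_eq (hA : IsLiftedModel σ ω r s T A) (hB : IsLiftedModel σ ω' r' s' T' B)
    (hσ : 0 < σ) (hU : ∀ x, U (T x) = T' (U x)) : s = s' := by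
  obtain ⟨y, hy⟩ := hB.surjective (U (A (0, 0, 0, 0, 1)))
  obtain ⟨x, hx⟩ := hA.surjective (U.symm (B (0, 0, 0, 0, 1)))
  have h1 := hA.norm_last_eq hB hσ hU hy.symm
  have h2 := hA.norm_last_eq hB hσ hU (x := x) (by rw [hx, U.apply_symm_apply])
  -- If the flags differ, the unit vector of the last coordinate on the side with flag 1 would have
  -- second difference zero, by comparison with the other side.
  rcases hA.flag with ⟨h, -⟩ | h <;> rcases hB.flag with ⟨h', -⟩ | h' <;>
    rw [h, h'] at h1 h2 ⊢
  · norm_num at h2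
  · norm_num at h1

/-- The last basis vector has squared norm $1 + r^2$. Its image has $|\alpha| = 1$, hence squared
norm at least $1 + r'^2$. -/
theorem r_le (hA : IsLiftedModel σ ω r 1 T A) (hB : IsLiftedModel σ ω' r' 1 T' B)
    (hσ : 0 < σ) (hr : 0 ≤ r) (hU : ∀ x, U (T x) = T' (U x)) : r' ≤ r := by
  obtain ⟨y, hy⟩ := hB.surjective (U (A (0, 0, 0, 0, 1)))
  have h1 := hA.norm_last_eq hB hσ hU hy.symm
  have h2 := hB.norm_sq_map y
  rw [hy, U.norm_map, hA.norm_sq_map] at h2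
  simp only [norm_zero, norm_one, one_pow, one_mul, mul_one] at h1 h2
  refine abs_le_of_sq_le_sq' (a := r') (b := r) ?_ hr |>.2
  rw [← h1] at h2
  have : 0 ≤ r' ^ 2 * ‖y.2.1‖ ^ 2 := by positivity
  nlinarith [sq_nonneg ‖y.1‖, sq_nonneg ‖y.2.2.1‖, sq_nonneg ‖y.2.2.2.1‖]

theorem omega_eq (hA : IsLiftedModel σ ω r 1 T A) (hB : IsLiftedModel σ ω' r' 1 T' B)
    (hσ : 0 < σ) (hU : ∀ x, U (T x) = T' (U x)) : ω = ω' := by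
  obtain ⟨y, hy⟩ := hB.surjective (U (A (0, 0, 0, 0, 1)))
  have h1 := hA.norm_last_eq hB hσ hU hy.symm
  -- Applying $T - \omega$ kills the last coordinate on the left and multiplies it by $\omega' -
  -- \omega$ on the right, where it has modulus 1.
  have h2 : U (A (liftedModelShift σ ω 1 (0, 0, 0, 0, 1) - ω • (0, 0, 0, 0, 1))) =
      B (liftedModelShift σ ω' 1 y - ω • y) := by
    rw [map_sub, map_sub, map_sub, map_smul, map_smul, map_smul, ← hA.map_shift, ← hB.map_shift,
      hU, hy]
  have h3 := hA.norm_last_eq hB hσ hU h2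
  simp only [liftedModelShift, Prod.snd_sub, Prod.smul_snd, smul_eq_mul, mul_one, sub_self,
    norm_zero, ← sub_mul, norm_mul, mul_pow, one_pow, one_mul, norm_one] at h1 h3
  rw [← h1, mul_one] at h3
  have : ω' - ω = 0 := by simpa using h3.symm
  exact (sub_eq_zero.1 this).symm

/-- The model sees the multiplicity space only up to a unitary, because composition with a constant
unitary commutes with the shift on the third coordinate. -/
theorem comp_mapIsometry (hA : IsLiftedModel σ ω r s T A) (V : E' ≃ₗᵢ[ℂ] E) :
    ∃ B : LiftedModelSpace E' →ₗ[ℂ] K, IsLiftedModel σ ω r s T B := by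
  let V' : LiftedModelSpace E' →ₗ[ℂ] LiftedModelSpace E :=
    LinearMap.prodMap LinearMap.id <| LinearMap.prodMap LinearMap.id <|
      LinearMap.prodMap (HardyDisc.mapIsometry V.toLinearIsometry).toLinearMap LinearMap.id
  have hV : ∀ x : LiftedModelSpace E',
      V' x = (x.1, x.2.1, HardyDisc.mapIsometry V.toLinearIsometry x.2.2.1, x.2.2.2) := fun _ => rfl
  refine ⟨A ∘ₗ V', hA.norm_omega, hA.flag, hA.surjective.comp ?_, fun x y => ?_, fun x => ?_⟩
  · rintro ⟨G, k, u, t⟩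
    refine ⟨(G, k, HardyDisc.mapIsometry V.symm.toLinearIsometry u, t), ?_⟩
    rw [hV]
    simp only [Prod.mk.injEq, and_true, true_and]
    ext z
    simp
  · rw [LinearMap.comp_apply, LinearMap.comp_apply, hA.inner_map, hV, hV]
    simp only [LinearIsometry.inner_map_map]
  · rw [LinearMap.comp_apply, LinearMap.comp_apply, hA.map_shift, hV, hV]
    congr 1
    simp only [liftedModelShift, Prod.mk.injEq, and_true, true_and]
    ext z
    simp

theorem exists_unitary {B : LiftedModelSpace E →ₗ[ℂ] L} (hA : IsLiftedModel σ ω r s T A)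
    (hB : IsLiftedModel σ ω r s T' B) : ∃ U : K ≃ₗᵢ[ℂ] L, ∀ x, U (T x) = T' (U x) := by
  obtain ⟨U, hU⟩ := exists_unitary_of_norm_eq hA.surjective hB.surjective fun x => by
    rw [← sq_eq_sq₀ (norm_nonneg _) (norm_nonneg _), hA.norm_sq_map, hB.norm_sq_map]
  refine ⟨U, hA.surjective.forall.2 fun x => ?_⟩
  rw [hA.map_shift, hU, hU, hB.map_shift]

end IsLiftedModel

end Model

/-- Polarization. -/
theorem LinearMap.inner_map_map_of_norm_eq_mul {H H' : Type*} [NormedAddCommGroup H]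
    [InnerProductSpace ℂ H] [NormedAddCommGroup H'] [InnerProductSpace ℂ H'] {V : H →ₗ[ℂ] H'}
    {C : ℝ} (hV : ∀ x, ‖V x‖ = C * ‖x‖) (x y : H) : ⟪V x, V y⟫_ℂ = C ^ 2 * ⟪x, y⟫_ℂ := by
  rw [inner_eq_sum_norm_sq_div_four, inner_eq_sum_norm_sq_div_four]
  simp only [← map_smul, ← map_add, ← map_sub, hV]
  have hC : ((C : ℝ) : ℂ) = RCLike.ofReal C := rfl
  push_cast
  rw [hC]
  ring

/-! ### Multiplication operators by inner functions -/

section Multipliers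

variable {E : Type u} [NormedAddCommGroup E] [InnerProductSpace ℂ E] [CompleteSpace E]

/-- Multiplication by an inner function as an isometry `H²(𝔻; E) → H²(𝔻; F)`. -/
def IsInner.mulIsometry {F : Type v} [NormedAddCommGroup F] [InnerProductSpace ℂ F]
    [CompleteSpace F] {Ψ : ℂ → E →L[ℂ] F} (hΨ : IsInner Ψ) : HardyDisc E →ₗᵢ[ℂ] HardyDisc F where
  toFun f := ⟨fun z => Ψ z (f z), by
    obtain ⟨h, hh, -⟩ := hΨ.2 f
    have : h.1 = fun z : 𝔻 => Ψ z (f z) := funext hh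
    exact this ▸ h.2⟩
  map_add' f g := HardyDisc.ext fun z => map_add (Ψ z) (f z) (g z)
  map_smul' c f := HardyDisc.ext fun z => map_smul (Ψ z) c (f z)
  norm_map' f := by
    obtain ⟨h, hh, hn⟩ := hΨ.2 f
    rw [← hn]
    exact congrArg norm (HardyDisc.ext fun z => (hh z).symm)

variable {φ : ℂ → ℂ}

/-- Multiplication by a scalar inner function on `H²(𝔻)`. -/
def innerMul (hφ : IsScalarInner φ) : HardyDisc ℂ →ₗᵢ[ℂ] HardyDisc ℂ :=
  IsInner.mulIsometry hφ

@[simp] theorem innerMul_apply (hφ : IsScalarInner φ) (f : HardyDisc ℂ) (z : 𝔻) :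
    innerMul hφ f z = φ z * f z := rfl

/-- Multiplication by `φ_{z₂}` on `H²(𝔻²)` for a scalar inner function `φ`. -/
def bidiscInnerMul (hφ : IsScalarInner φ) : HardyBidisc →ₗᵢ[ℂ] HardyBidisc :=
  HardyBidisc.ofHardyDisc.toLinearIsometry.comp <|
    (HardyDisc.mapIsometry (innerMul hφ)).comp HardyBidisc.ofHardyDisc.symm.toLinearIsometry

@[simp] theorem bidiscInnerMul_apply (hφ : IsScalarInner φ) (G : HardyBidisc) (z w : 𝔻) :
    bidiscInnerMul hφ G (z, w) = φ w * G (z, w) := by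
  obtain ⟨G, rfl⟩ := HardyBidisc.ofHardyDisc.surjective G
  simp [bidiscInnerMul]

/-- The operator `f ↦ g_{z₂} f_{z₁}` from `H²(𝔻)` to `H²(𝔻²)`. -/
def bidiscTensor (g : HardyDisc ℂ) : HardyDisc ℂ →ₗ[ℂ] HardyBidisc where
  toFun f := ⟨fun p => g p.2 * f p.1, by
    obtain ⟨h, hh, -⟩ := HardyDisc.exists_map (ContinuousLinearMap.toSpanSingleton ℂ g)
      (norm_nonneg g) (fun c => by simp [norm_smul, mul_comm]) f
    have : (HardyBidisc.ofHardyDisc h).1 = fun p : 𝔻 × 𝔻 => g p.2 * f p.1 := by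
      funext p
      change h p.1 p.2 = _
      rw [hh]
      exact mul_comm (f p.1) (g p.2)
    exact this ▸ (HardyBidisc.ofHardyDisc h).2⟩
  map_add' f k := HardyBidisc.ext fun p => mul_add (g p.2) (f p.1) (k p.1)
  map_smul' c f := HardyBidisc.ext fun p => mul_left_comm (g p.2) c (f p.1)

@[simp] theorem bidiscTensor_apply (g f : HardyDisc ℂ) (z w : 𝔻) :
    bidiscTensor g f (z, w) = g w * f z := rfl

theorem norm_bidiscTensor (g f : HardyDisc ℂ) : ‖bidiscTensor g f‖ = ‖g‖ * ‖f‖ := by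
  obtain ⟨h, hh, hn⟩ := HardyDisc.exists_map (ContinuousLinearMap.toSpanSingleton ℂ g)
    (norm_nonneg g) (fun c => by simp [norm_smul, mul_comm]) f
  rw [← hn, ← HardyBidisc.ofHardyDisc.norm_map]
  refine congrArg norm (HardyBidisc.ext fun p => ?_)
  change _ = h p.1 p.2
  rw [hh]
  exact mul_comm (g p.2) (f p.1)

/-- The operator `f ↦ Ψ f` from `H²(𝔻; E)` to `H²(𝔻²)` for an inner function `Ψ` with values in
`𝓑(E, K_φ)`. -/
def bidiscOperatorMul {Ψ : ℂ → E →L[ℂ] ModelSpace φ} (hΨ : IsInner Ψ) :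
    HardyDisc E →ₗᵢ[ℂ] HardyBidisc :=
  (HardyBidisc.ofHardyDisc.toLinearIsometry.comp
    (HardyDisc.mapIsometry (ModelSpace φ).subtypeₗᵢ)).comp hΨ.mulIsometry

@[simp] theorem bidiscOperatorMul_apply {Ψ : ℂ → E →L[ℂ] ModelSpace φ} (hΨ : IsInner Ψ)
    (f : HardyDisc E) (z w : 𝔻) :
    bidiscOperatorMul hΨ f (z, w) = (Ψ z (f z) : HardyDisc ℂ) w := rfl

theorem mem_innerRange_iff (hφ : IsScalarInner φ) {h : HardyDisc ℂ} :
    h ∈ innerRange φ ↔ ∃ f, innerMul hφ f = h :=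
  exists_congr fun _ => ⟨fun H => HardyDisc.ext fun z => (H z).symm, fun H z => by rw [← H]; rfl⟩

theorem mem_bidiscInnerRange_iff (hφ : IsScalarInner φ) {H : HardyBidisc} :
    H ∈ bidiscInnerRange φ ↔ ∃ G, bidiscInnerMul hφ G = H :=
  exists_congr fun _ => ⟨fun h => HardyBidisc.ext fun p =>
    (bidiscInnerMul_apply hφ _ p.1 p.2).trans (h p.1 p.2).symm, fun h z w => by rw [← h]; simp⟩

theorem mem_bidiscTensorRange_iff {g : HardyDisc ℂ} {H : HardyBidisc} :
    H ∈ bidiscTensorRange g ↔ ∃ f, bidiscTensor g f = H :=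
  exists_congr fun _ => ⟨fun h => HardyBidisc.ext fun p => (h p.1 p.2).symm,
    fun h z w => by rw [← h]; rfl⟩

theorem mem_bidiscOperatorRange_iff {Ψ : ℂ → E →L[ℂ] ModelSpace φ} (hΨ : IsInner Ψ)
    {H : HardyBidisc} : H ∈ bidiscOperatorRange Ψ ↔ ∃ f, bidiscOperatorMul hΨ f = H :=
  exists_congr fun _ => ⟨fun h => HardyBidisc.ext fun p => (h p.1 p.2).symm,
    fun h z w => by rw [← h]; rfl⟩

/-! ### Lifted subspaces satisfy the model -/

/-- The parametrization of a lifted subspace by quintuples `(G, k, u, h, α)`. The constant `c` is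
the boundary value of `φ`. -/
def liftedParam {Ψ : ℂ → E →L[ℂ] ModelSpace φ} (hφ : IsScalarInner φ) (hΨ : IsInner Ψ)
    (g : HardyDisc ℂ) (c : ℂ) (s : ℝ) : LiftedModelSpace E →ₗ[ℂ] BrownianSpace where
  toFun x := WithLp.toLp 2
    (bidiscInnerMul hφ (conj c • x.1) + bidiscTensor g x.2.1 + bidiscOperatorMul hΨ x.2.2.1,
      WithLp.toLp 2 (innerMul hφ (conj c • x.2.2.2.1) + ((s : ℂ) * x.2.2.2.2) • g,
        (s : ℂ) * x.2.2.2.2))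
  map_add' x y := by
    simp only [Prod.fst_add, Prod.snd_add, smul_add, map_add, mul_add, add_smul, ← WithLp.toLp_add,
      Prod.mk_add_mk]
    congr 2
    · abel
    · congr 2
      abel
  map_smul' a x := by
    simp only [Prod.smul_fst, Prod.smul_snd, map_smul, smul_eq_mul, RingHom.id_apply,
      smul_comm (conj c) a, ← smul_add, ← WithLp.toLp_smul, Prod.smul_mk, mul_left_comm _ a,
      mul_smul a]

theorem liftedParam_apply {Ψ : ℂ → E →L[ℂ] ModelSpace φ} (hφ : IsScalarInner φ) (hΨ : IsInner Ψ)
    (g : HardyDisc ℂ) (c : ℂ) (s : ℝ) (x : LiftedModelSpace E) :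
    liftedParam hφ hΨ g c s x = WithLp.toLp 2
      (bidiscInnerMul hφ (conj c • x.1) + bidiscTensor g x.2.1 + bidiscOperatorMul hΨ x.2.2.1,
        WithLp.toLp 2 (innerMul hφ (conj c • x.2.2.2.1) + ((s : ℂ) * x.2.2.2.2) • g,
          (s : ℂ) * x.2.2.2.2)) := rfl

/-- The orthogonality hypotheses give the inner product formula. For the operator, $\alpha g$ in the
middle component contributes $\sigma\alpha$ to `k` after embedding, and the relation for $zg +
\sigma$ contributes $\sigma\alpha$ to `h` and $\omega\alpha$ to the last coordinate. The factor
$\overline{c}$ in `liftedParam` absorbs the boundary value, so that these constants do not depend on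
it; $|c| = 1$ keeps the norm. -/
theorem exists_isLiftedModel {Ψ : ℂ → E →L[ℂ] ModelSpace φ} (hφ : IsScalarInner φ)
    (hΨ : IsInner Ψ) {g : HardyDisc ℂ} {c ω : ℂ} {σ θ s : ℝ} {M : Submodule ℂ BrownianSpace}
    (hMinv : ∀ x ∈ M, threeBrownianShift σ θ x ∈ M)
    (hφg : bidiscInnerRange φ ⟂ bidiscTensorRange g)
    (hφΨ : bidiscInnerRange φ ⟂ bidiscOperatorRange Ψ)
    (hgΨ : bidiscTensorRange g ⟂ bidiscOperatorRange Ψ)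
    (hg : ∀ h, ⟪g, innerMul hφ h⟫_ℂ = 0) (hc : ‖c‖ = 1) (hω : ‖ω‖ = 1)
    (hs : s = 0 ∧ g = 0 ∨ s = 1 ∧ ω = Complex.exp (Complex.I * θ) ∧
      ∀ z : 𝔻, z * g z + σ = ω * g z + σ * (conj c * φ z))
    (hM : ∀ x, x ∈ M ↔ ∃ p, liftedParam hφ hΨ g c s p = x) :
    ∃ A : LiftedModelSpace E →ₗ[ℂ] M, IsLiftedModel σ ω ‖g‖ s
      (fun x : M => ⟨threeBrownianShift σ θ x, hMinv x x.2⟩) A := by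
  have hcc : c * conj c = 1 := by
    rw [Complex.mul_conj, Complex.normSq_eq_norm_sq, hc]; simp
  have h12 : ∀ G k, ⟪bidiscInnerMul hφ G, bidiscTensor g k⟫_ℂ = 0 := fun G k =>
    Submodule.isOrtho_iff_inner_eq.1 hφg _ ((mem_bidiscInnerRange_iff hφ).2 ⟨_, rfl⟩) _
      (mem_bidiscTensorRange_iff.2 ⟨_, rfl⟩)
  have h13 : ∀ G k, ⟪bidiscInnerMul hφ G, bidiscOperatorMul hΨ k⟫_ℂ = 0 := fun G k =>
    Submodule.isOrtho_iff_inner_eq.1 hφΨ _ ((mem_bidiscInnerRange_iff hφ).2 ⟨_, rfl⟩) _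
      ((mem_bidiscOperatorRange_iff hΨ).2 ⟨_, rfl⟩)
  have h23 : ∀ G k, ⟪bidiscTensor g G, bidiscOperatorMul hΨ k⟫_ℂ = 0 := fun G k =>
    Submodule.isOrtho_iff_inner_eq.1 hgΨ _ (mem_bidiscTensorRange_iff.2 ⟨_, rfl⟩) _
      ((mem_bidiscOperatorRange_iff hΨ).2 ⟨_, rfl⟩)
  have h21 := fun G k => inner_eq_zero_symm.1 (h12 G k)
  have h31 := fun G k => inner_eq_zero_symm.1 (h13 G k)
  have h32 := fun G k => inner_eq_zero_symm.1 (h23 G k)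
  have hg' := fun h => inner_eq_zero_symm.1 (hg h)
  refine ⟨(liftedParam hφ hΨ g c s).codRestrict M fun p => (hM _).2 ⟨p, rfl⟩, hω, ?_, ?_, ?_, ?_⟩
  · exact hs.imp (fun h => ⟨h.1, by simp [h.2]⟩) fun h => h.1
  · rintro ⟨x, hx⟩
    obtain ⟨p, hp⟩ := (hM x).1 hx
    exact ⟨p, Subtype.ext hp⟩
  · intro x y
    rw [Submodule.coe_inner, LinearMap.codRestrict_apply, LinearMap.codRestrict_apply,
      liftedParam_apply, liftedParam_apply]
    simp only [WithLp.prod_inner_apply, inner_add_left, inner_add_right, h12, h13, h23, h21, h31,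
      h32, inner_smul_left, inner_smul_right, hg, hg', LinearIsometry.inner_map_map,
      LinearMap.inner_map_map_of_norm_eq_mul (norm_bidiscTensor g), RCLike.inner_apply,
      inner_self_eq_norm_sq_to_K, map_mul, Complex.conj_conj, Complex.conj_ofReal,
      Complex.coe_algebraMap]
    linear_combination (⟪x.1, y.1⟫_ℂ + ⟪x.2.2.2.1, y.2.2.2.1⟫_ℂ) * hcc
  · intro x
    refine Subtype.ext ?_
    change threeBrownianShift σ θ (liftedParam hφ hΨ g c s x) = liftedParam hφ hΨ g c s _
    rw [liftedParam_apply, liftedParam_apply, threeBrownianShift_apply]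
    congr 2
    · ext ⟨z, w⟩
      simp [liftedModelShift, -Complex.coe_smul]
      ring
    · congr 2
      · ext z
        simp only [liftedModelShift, HardyDisc.add_apply, HardyDisc.smul_apply,
          HardyDisc.hardyShift_apply, HardyDisc.hardyConst_apply, innerMul_apply, smul_eq_mul]
        rcases hs with ⟨rfl, rfl⟩ | ⟨rfl, -, h⟩
        · simp only [HardyDisc.zero_apply]
          push_cast
          ring
        · push_cast
          linear_combination x.2.2.2.2 * h z
      · simp only [liftedModelShift]
        rcases hs with ⟨rfl, rfl⟩ | ⟨rfl, h, -⟩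
        · simp
        · rw [h]
          ring

/-- Type I is the degenerate case $g = 0$, $s = 0$. The last coordinate is then invisible, so
$\omega = 1$ is an arbitrary choice. -/
theorem IsLiftedTypeOne.exists_model {σ θ : ℝ} {M : Submodule ℂ BrownianSpace}
    (hMinv : ∀ x ∈ M, threeBrownianShift σ θ x ∈ M) (h : IsLiftedTypeOne E M) :
    ∃ A : LiftedModelSpace E →ₗ[ℂ] M, IsLiftedModel σ 1 0 0
      (fun x : M => ⟨threeBrownianShift σ θ x, hMinv x x.2⟩) A := by
  obtain ⟨φ, Ψ, hφ, hΨ, hφΨ, hM⟩ := h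
  have h0 : bidiscTensorRange 0 = ⊥ := by
    rw [eq_bot_iff]
    rintro H ⟨f, hf⟩
    exact HardyBidisc.ext fun p => by simpa using hf p.1 p.2
  have := exists_isLiftedModel hφ hΨ (g := 0) (c := 1) (ω := 1) (s := 0) hMinv (by simp [h0])
    hφΨ (by simp [h0]) (by simp) (by simp) (by simp) (by simp) fun x => ?_
  · simpa using this
  rw [hM]
  constructor
  · rintro ⟨h1, h2, h3⟩
    obtain ⟨y, hy, z, hz, hyz⟩ := Submodule.mem_sup.1 h1
    obtain ⟨G, rfl⟩ := (mem_bidiscInnerRange_iff hφ).1 hy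
    obtain ⟨u, rfl⟩ := (mem_bidiscOperatorRange_iff hΨ).1 hz
    obtain ⟨f, hf⟩ := (mem_innerRange_iff hφ).1 h2
    refine ⟨(G, 0, u, f, 0), ?_⟩
    rw [liftedParam_apply]
    simp [hyz, hf]
    rw [← h3]
    rfl
  · rintro ⟨p, rfl⟩
    rw [liftedParam_apply]
    refine ⟨?_, (mem_innerRange_iff hφ).2 ⟨p.2.2.2.1, by simp⟩, by simp⟩
    refine Submodule.mem_sup.2 ⟨_, (mem_bidiscInnerRange_iff hφ).2 ⟨p.1, rfl⟩, _,
      (mem_bidiscOperatorRange_iff hΨ).2 ⟨p.2.2.1, rfl⟩, ?_⟩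
    have : bidiscTensor 0 p.2.1 = 0 := HardyBidisc.ext fun q => by
      change (0 : HardyDisc ℂ) q.2 * p.2.1 q.1 = 0
      simp
    simp [this]

theorem IsLiftedTypeTwo.exists_model {σ θ : ℝ} {g : HardyDisc ℂ} {M : Submodule ℂ BrownianSpace}
    (hσ : σ ≠ 0) (hMinv : ∀ x ∈ M, threeBrownianShift σ θ x ∈ M)
    (h : IsLiftedTypeTwo E σ θ g M) :
    ∃ A : LiftedModelSpace E →ₗ[ℂ] M, IsLiftedModel σ (Complex.exp (Complex.I * θ)) ‖g‖ 1
      (fun x : M => ⟨threeBrownianShift σ θ x, hMinv x x.2⟩) A := by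
  obtain ⟨φ, Ψ, ⟨hφ, c, -, hgc⟩, hΨ, -, hline, hφg, hφΨ, hgΨ, hM⟩ := h
  have hω : ‖Complex.exp (Complex.I * θ)‖ = 1 := Complex.norm_exp_I_mul_ofReal θ
  set ω := Complex.exp (Complex.I * θ)
  have hg : ∀ h, ⟪g, innerMul hφ h⟫_ℂ = 0 := fun h => by
    have := Submodule.isOrtho_iff_inner_eq.1 hline (WithLp.toLp 2 (g, (1 : ℂ)))
      (Submodule.mem_span_singleton_self _) (WithLp.toLp 2 (innerMul hφ h, (0 : ℂ)))
      ⟨(mem_innerRange_iff hφ).2 ⟨h, rfl⟩, rfl⟩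
    simpa [WithLp.prod_inner_apply] using this
  -- This is the definition of $g$ with its denominator cleared; $z - \omega$ is nonzero since $|z|
  -- < 1 = |\omega|$.
  have hrel : ∀ z : 𝔻, z * g z + σ = ω * g z + σ * (conj c * φ z) := fun z => by
    have hz : (z : ℂ) - ω ≠ 0 := fun h0 => by
      have := z.norm_lt_one
      rw [sub_eq_zero.1 h0, hω] at this
      exact lt_irrefl _ this
    rw [hgc z]
    field_simp
    ring
  -- Comparison of squared norms in $zg + \sigma = \omega g + \sigma\overline{c}\varphi$: both sums
  -- are orthogonal, so $\|g\|^2 + \sigma^2 = \|g\|^2 + \sigma^2|c|^2$.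
  have hc : ‖c‖ = 1 := by
    have h1 : hardyShift g + (σ : ℂ) • hardyConst 1 =
        ω • g + (σ : ℂ) • innerMul hφ (hardyConst (conj c)) := by
      ext z
      simp only [HardyDisc.add_apply, HardyDisc.smul_apply, HardyDisc.hardyShift_apply,
        HardyDisc.hardyConst_apply, innerMul_apply, smul_eq_mul, mul_one]
      rw [hrel z]
      ring
    have h2 := congrArg (fun f => ‖f‖ ^ 2) h1
    beta_reduce at h2
    rw [HardyDisc.norm_sq_hardyShift_add, norm_sq_add_smul_of_inner_eq_zero, norm_smul, hω,
      LinearIsometry.norm_map, LinearIsometry.norm_map, RCLike.norm_conj] at h2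
    · have hσ' : ‖(σ : ℂ)‖ ^ 2 ≠ 0 := by simpa using hσ
      have h3 : ‖(σ : ℂ)‖ ^ 2 * ‖c‖ ^ 2 = ‖(σ : ℂ)‖ ^ 2 * 1 := by
        rw [norm_one] at h2
        linear_combination -h2
      exact (pow_eq_one_iff_of_nonneg (norm_nonneg c) two_ne_zero).1 (mul_left_cancel₀ hσ' h3)
    · rw [inner_smul_right, inner_eq_zero_symm.1 (hg _), mul_zero]
  have hcc : conj c * c = 1 := by
    rw [mul_comm, Complex.mul_conj, Complex.normSq_eq_norm_sq, hc]; simp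
  refine exists_isLiftedModel hφ hΨ hMinv hφg hφΨ hgΨ hg hc hω (Or.inr ⟨rfl, rfl, hrel⟩) fun x => ?_
  rw [hM]
  constructor
  · rintro ⟨h1, h2⟩
    obtain ⟨y, hy, z, hz, hyz⟩ := Submodule.mem_sup.1 h1
    obtain ⟨y₁, hy₁, y₂, hy₂, rfl⟩ := Submodule.mem_sup.1 hy
    obtain ⟨G, rfl⟩ := (mem_bidiscInnerRange_iff hφ).1 hy₁
    obtain ⟨k, rfl⟩ := mem_bidiscTensorRange_iff.1 hy₂
    obtain ⟨u, rfl⟩ := (mem_bidiscOperatorRange_iff hΨ).1 hz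
    obtain ⟨a, ha, b, hb, hab⟩ := Submodule.mem_sup.1 h2
    obtain ⟨α, rfl⟩ := Submodule.mem_span_singleton.1 ha
    obtain ⟨f, hf⟩ := (mem_innerRange_iff hφ).1 hb.1
    -- The factors `c` undo the $\overline{c}$ built into the parametrization.
    refine ⟨(c • G, k, u, c • f, α), ?_⟩
    rw [liftedParam_apply]
    simp only [smul_smul, hcc, one_smul, Complex.ofReal_one, one_mul, hyz, hf]
    have h3 : x.snd.fst = b.fst + α • g := by rw [← hab]; simp [add_comm]
    have h4 : x.snd.snd = α := by rw [← hab]; simp [hb.2]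
    rw [← h3, ← h4]
    rfl
  · rintro ⟨p, rfl⟩
    rw [liftedParam_apply]
    refine ⟨?_, ?_⟩
    · exact Submodule.add_mem_sup (Submodule.add_mem_sup ((mem_bidiscInnerRange_iff hφ).2 ⟨_, rfl⟩)
        (mem_bidiscTensorRange_iff.2 ⟨_, rfl⟩)) ((mem_bidiscOperatorRange_iff hΨ).2 ⟨_, rfl⟩)
    · refine Submodule.mem_sup.2 ⟨_, Submodule.smul_mem _ p.2.2.2.2
        (Submodule.mem_span_singleton_self _),
        WithLp.toLp 2 (innerMul hφ (conj c • p.2.2.2.1), (0 : ℂ)),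
        ⟨(mem_innerRange_iff hφ).2 ⟨_, rfl⟩, rfl⟩, ?_⟩
      simp [← WithLp.toLp_smul, ← WithLp.toLp_add, add_comm]

end Multipliers

/-! ### Hilbert space dimension and unitary equivalence -/

section Dimension

variable (E : Type u) [NormedAddCommGroup E] [InnerProductSpace ℂ E]

theorem exists_hilbertBasis_mk_eq_hilbertDim [CompleteSpace E] :
    ∃ s : Set E, Nonempty (HilbertBasis s ℂ E) ∧ Cardinal.mk s = hilbertDim E := by
  refine csInf_mem (s := {κ | ∃ s : Set E, Nonempty (HilbertBasis s ℂ E) ∧ Cardinal.mk s = κ}) ?_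
  obtain ⟨w, b, -⟩ := exists_hilbertBasis ℂ E
  exact ⟨_, w, ⟨b⟩, rfl⟩

variable {E}

/-- A Hilbert basis can be reindexed along an equivalence. -/
theorem HilbertBasis.nonempty_of_equiv [CompleteSpace E] {ι κ : Type*} (b : HilbertBasis ι ℂ E) (e : κ ≃ ι) :
    Nonempty (HilbertBasis κ ℂ E) := by
  refine ⟨(HilbertBasis.mk (b.orthonormal.comp e e.injective) ?_)⟩
  rw [e.surjective.range_comp]
  exact b.dense_span.ge

theorem hilbertDim_le_of_equiv [CompleteSpace E] {F : Type v} [NormedAddCommGroup F]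
    [InnerProductSpace ℂ F] [CompleteSpace F] (V : E ≃ₗᵢ[ℂ] F) :
    Cardinal.lift.{u} (hilbertDim F) ≤ Cardinal.lift.{v} (hilbertDim E) := by
  obtain ⟨s, ⟨b⟩, hs⟩ := exists_hilbertBasis_mk_eq_hilbertDim E
  have b' : HilbertBasis s ℂ F := ⟨V.symm.trans b.repr⟩
  have hc := Cardinal.mk_range_eq_of_injective b'.orthonormal.linearIndependent.injective
  -- `hilbertDim F` ranges over index sets that are subsets of `F`, so the transported basis is
  -- reindexed by its own range.
  obtain ⟨c⟩ := b'.nonempty_of_equiv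
    (Equiv.ofInjective _ b'.orthonormal.linearIndependent.injective).symm
  rw [← hs, ← hc, Cardinal.lift_le]
  exact csInf_le' ⟨_, ⟨c⟩, rfl⟩

theorem lift_hilbertDim_eq_iff [CompleteSpace E] {F : Type v} [NormedAddCommGroup F]
    [InnerProductSpace ℂ F] [CompleteSpace F] :
    Cardinal.lift.{v} (hilbertDim E) = Cardinal.lift.{u} (hilbertDim F) ↔
      Nonempty (E ≃ₗᵢ[ℂ] F) := by
  constructor
  · intro h
    obtain ⟨s, ⟨b⟩, hs⟩ := exists_hilbertBasis_mk_eq_hilbertDim E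
    obtain ⟨t, ⟨c⟩, ht⟩ := exists_hilbertBasis_mk_eq_hilbertDim F
    rw [← hs, ← ht, Cardinal.lift_mk_eq'] at h
    obtain ⟨e⟩ := h
    obtain ⟨c'⟩ := c.nonempty_of_equiv e
    exact ⟨b.repr.trans c'.repr.symm⟩
  · rintro ⟨V⟩
    exact le_antisymm (hilbertDim_le_of_equiv V.symm) (hilbertDim_le_of_equiv V)

end Dimension

theorem Real.eq_of_exp_I_mul_eq {θ₁ θ₂ : ℝ} (h₁ : θ₁ ∈ Set.Ico 0 (2 * Real.pi))
    (h₂ : θ₂ ∈ Set.Ico 0 (2 * Real.pi))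
    (h : Complex.exp (Complex.I * θ₁) = Complex.exp (Complex.I * θ₂)) : θ₁ = θ₂ := by
  obtain ⟨n, hn⟩ := Complex.exp_eq_exp_iff_exists_int.1 h
  have h' : θ₁ = θ₂ + n * (2 * Real.pi) := by
    have : Complex.I * θ₁ = Complex.I * ((θ₂ + n * (2 * Real.pi) : ℝ) : ℂ) := by
      rw [hn]
      push_cast
      ring
    exact Complex.ofReal_injective (mul_left_cancel₀ Complex.I_ne_zero this)
  have h1 : (n : ℝ) < 1 := by nlinarith [h₁.2, h₂.1, Real.pi_pos]
  have h2 : (-1 : ℝ) < n := by nlinarith [h₁.1, h₂.2, Real.pi_pos]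
  have h3 : n < 1 := by exact_mod_cast h1
  have h4 : -1 < n := by exact_mod_cast h2
  obtain rfl : n = 0 := by omega
  simpa using h'

end

/-! ### The classification -/

theorem theorem1p1
    (σ₁ σ₂ θ₁ θ₂ : ℝ) (hσ₁ : 0 < σ₁) (hσ₂ : 0 < σ₂)
    (hθ₁ : θ₁ ∈ Set.Ico 0 (2 * Real.pi)) (hθ₂ : θ₂ ∈ Set.Ico 0 (2 * Real.pi))
    (E_M : Type u) [NormedAddCommGroup E_M] [InnerProductSpace ℂ E_M] [CompleteSpace E_M]
    (E_N : Type v) [NormedAddCommGroup E_N] [InnerProductSpace ℂ E_N] [CompleteSpace E_N]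
    (M N : Submodule ℂ BrownianSpace)
    (hM0 : M ≠ ⊥) (hN0 : N ≠ ⊥)
    (hMc : IsClosed (M : Set BrownianSpace)) (hNc : IsClosed (N : Set BrownianSpace))
    (hMinv : ∀ x ∈ M, threeBrownianShift σ₁ θ₁ x ∈ M)
    (hNinv : ∀ x ∈ N, threeBrownianShift σ₂ θ₂ x ∈ N)
    (hM : IsLiftedTypeOne E_M M ∨ ∃ g, IsLiftedTypeTwo E_M σ₁ θ₁ g M)
    (hN : IsLiftedTypeOne E_N N ∨ ∃ g, IsLiftedTypeTwo E_N σ₂ θ₂ g N) :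
    RestrictionsUnitarilyEquivalent (threeBrownianShift σ₁ θ₁) (threeBrownianShift σ₂ θ₂)
        M N hMinv hNinv ↔
      σ₁ = σ₂ ∧
      Cardinal.lift.{v} (hilbertDim E_M) = Cardinal.lift.{u} (hilbertDim E_N) ∧
      ((IsLiftedTypeOne E_M M ∧ IsLiftedTypeOne E_N N) ∨
        (θ₁ = θ₂ ∧ ∃ g₁ g₂ : HardyDisc ℂ,
          IsLiftedTypeTwo E_M σ₁ θ₁ g₁ M ∧ IsLiftedTypeTwo E_N σ₂ θ₂ g₂ N ∧ ‖g₁‖ = ‖g₂‖)) := by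
  have hσ₁' := hσ₁.ne'
  have hσ₂' := hσ₂.ne'
  constructor
  · rintro ⟨U, hU⟩
    have hU' : ∀ x : N, U.symm ⟨threeBrownianShift σ₂ θ₂ x, hNinv x x.2⟩ =
        ⟨threeBrownianShift σ₁ θ₁ (U.symm x), hMinv _ (U.symm x).2⟩ := fun x => by
      simp only [U.symm_apply_eq, hU, U.apply_symm_apply]
    rcases hM with hM | ⟨g₁, hM⟩ <;> rcases hN with hN | ⟨g₂, hN⟩
    · obtain ⟨A, hA⟩ := hM.exists_model hMinv
      obtain ⟨B, hB⟩ := hN.exists_model hNinv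
      exact ⟨(hA.sigma_le hB hσ₂.le hU).antisymm (hB.sigma_le hA hσ₁.le hU'),
        lift_hilbertDim_eq_iff.2 (hA.nonempty_multiplicity_equiv hB hσ₁' hσ₂' hU),
        Or.inl ⟨hM, hN⟩⟩
    · obtain ⟨A, hA⟩ := hM.exists_model hMinv
      obtain ⟨B, hB⟩ := hN.exists_model hσ₂' hNinv
      obtain rfl := (hA.sigma_le hB hσ₂.le hU).antisymm (hB.sigma_le hA hσ₁.le hU')
      -- Subspaces of different type are never equivalent: their flags would have to agree.
      exact absurd (hA.flag_eq hB hσ₁ hU) zero_ne_one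
    · obtain ⟨A, hA⟩ := hM.exists_model hσ₁' hMinv
      obtain ⟨B, hB⟩ := hN.exists_model hNinv
      obtain rfl := (hA.sigma_le hB hσ₂.le hU).antisymm (hB.sigma_le hA hσ₁.le hU')
      exact absurd (hA.flag_eq hB hσ₁ hU) one_ne_zero
    · obtain ⟨A, hA⟩ := hM.exists_model hσ₁' hMinv
      obtain ⟨B, hB⟩ := hN.exists_model hσ₂' hNinv
      obtain rfl := (hA.sigma_le hB hσ₂.le hU).antisymm (hB.sigma_le hA hσ₁.le hU')
      exact ⟨rfl, lift_hilbertDim_eq_iff.2 (hA.nonempty_multiplicity_equiv hB hσ₁' hσ₂' hU),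
        Or.inr ⟨Real.eq_of_exp_I_mul_eq hθ₁ hθ₂ (hA.omega_eq hB hσ₁ hU), g₁, g₂, hM, hN,
          (hB.r_le hA hσ₁ (norm_nonneg _) hU').antisymm (hA.r_le hB hσ₁ (norm_nonneg _) hU)⟩⟩
  · rintro ⟨rfl, hdim, h⟩
    obtain ⟨V⟩ := lift_hilbertDim_eq_iff.1 hdim
    rcases h with ⟨hM, hN⟩ | ⟨rfl, g₁, g₂, hM, hN, hg⟩
    · obtain ⟨A, hA⟩ := hM.exists_model hMinv
      obtain ⟨B, hB⟩ := hN.exists_model hNinv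
      -- Once both multiplicity spaces are identified through `V`, the two models have the same
      -- data.
      obtain ⟨B', hB'⟩ := hB.comp_mapIsometry V
      exact hA.exists_unitary hB'
    · obtain ⟨A, hA⟩ := hM.exists_model hσ₁' hMinv
      obtain ⟨B, hB⟩ := hN.exists_model hσ₁' hNinv
      obtain ⟨B', hB'⟩ := hB.comp_mapIsometry V
      rw [← hg] at hB'
      exact hA.exists_unitary hB'
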